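/- Let $k$ be a field and let $(H,\mathcal R)$ be a quasitriangular Hopf algebra over $k$, where $\mathcal R=\mathcal R^{(1)}\otimes\mathcal R^{(2)}\in H\otimes H$ is invertible with inverse $\mathcal R^{-(1)}\otimes\mathcal R^{-(2)}$, $(\Delta\otimes\mathrm{id})\mathcal R=\mathcal R_{13}\mathcal R_{23}$, $(\mathrm{id}\otimes\Delta)\mathcal R=\mathcal R_{13}\mathcal R_{12}$ and $\tau\Delta(h)=\mathcal R\,\Delta(h)\,\mathcal R^{-1}$. Let $B$ and $C$ be braided groups (Hopf algebras) in the braided category of right $H$-modules, with braiding $\Psi(v\otimes w)=w\triangleleft\mathcal R^{(1)}\otimes v\triangleleft\mathcal R^{(2)}$, and write $\underline\Delta b=b_{(1)}\otimes b_{(2)}$ and $\underline\epsilon,\underline S$ for their braided coproducts, counits and antipodes. Assume that $\underline S$ is bijective on $C$, and let $\mathrm{ev}:C\otimes B\to k$ be a categorical duality pairing, that is, an $H$-invariant linear map with $\mathrm{ev}(cd,b)=\mathrm{ev}(d,b_{(1)})\,\mathrm{ev}(c,b_{(2)})$, $\mathrm{ev}(c,ab)=\mathrm{ev}(c_{(2)},a)\,\mathrm{ev}(c_{(1)},b)$,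 $\mathrm{ev}(1,b)=\underline\epsilon(b)$ and $\mathrm{ev}(c,1)=\underline\epsilon(c)$; no non-degeneracy or finite-dimensionality is assumed. Let $\bar C$ be the vector space $C$ with the same unit and counit, the opposite product, the left $H$-action $h\triangleright c=c\triangleleft Sh$, the coproduct $\bar\Delta c=c_{\bar{(1)}}\otimes c_{\bar{(2)}}=\mathcal R^{-(1)}\triangleright c_{(1)}\otimes\mathcal R^{-(2)}\triangleright c_{(2)}$ (iterated as $c_{\bar{(1)}}\otimes c_{\bar{(2)}}\otimes c_{\bar{(3)}}$), and $\bar S=\underline S^{-1}$; put $\langle c,b\rangle=\mathrm{ev}(c,b)$. Let $U=U(\bar C,H,B)$ be the double bosonisation, that is, $\bar C\otimes H\otimes B$ with unit $1\otimes1\otimes1$, counit $\underline\epsilon\otimes\epsilon\otimes\underline\epsilon$, product $$(c\otimes h\otimes b)(d\otimes g\otimes a)=c\,(h_{(1)}\mathcal R_1^{(2)}\triangleright d_{\bar{(2)}})\otimes h_{(2)}\mathcal R_2^{(2)}\mathcal R_1^{-(1)}g_{(1)}\otimes(b_{(2)}\triangleleft\mathcal R_2^{-(1)}g_{(2)})\,a\;\langle\mathcal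 R_1^{(1)}\triangleright d_{\bar{(1)}},\,b_{(1)}\triangleleft\mathcal R_2^{(1)}\rangle\,\langle\mathcal R_1^{-(2)}\triangleright\bar S d_{\bar{(3)}},\,b_{(3)}\triangleleft\mathcal R_2^{-(2)}\rangle$$ ($\mathcal R_1,\mathcal R_2$ being distinct copies of $\mathcal R$, and the first product being that of $\bar C$) and coproduct $$\Delta(c\otimes h\otimes b)=\big(c_{\bar{(1)}}\otimes\mathcal R^{-(1)}h_{(1)}\otimes b_{(1)}\triangleleft\mathcal R^{(1)}\big)\otimes\big(\mathcal R^{-(2)}\triangleright c_{\bar{(2)}}\otimes h_{(2)}\mathcal R^{(2)}\otimes b_{(2)}\big).$$ **Theorem.** There is a unique bilinear map $\triangleleft:B\times U\to B$ which makes the algebra $B$ a right $U$-module algebra, meaning $$v\triangleleft 1=v,\quad v\triangleleft(xy)=(v\triangleleft x)\triangleleft y,\quad 1\triangleleft x=\epsilon(x)1,\quad (vw)\triangleleft x=(v\triangleleft x_{(1)})(w\triangleleft x_{(2)})\qquad(v,w\in B,\ x,y\in U),$$ and which is given on the factors $B,\bar C,H\subseteq U$ as follows: $B$ acts by the right braided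 adjoint action $$v\triangleleft b=(\underline S b_{(1)}\triangleleft\mathcal R^{(1)})(v\triangleleft\mathcal R^{(2)})\,b_{(2)},$$ $\bar C$ acts by braided differentiation (the coregular action) $$v\triangleleft c=\langle\bar S c,\,v_{(2)}\triangleleft\mathcal R^{-(2)}\rangle\; v_{(1)}\triangleleft\mathcal R^{-(1)},$$ and $H$ acts tautologically, by the given action on $B$. (This is the fundamental or Schrödinger representation of $U$.) -/

import Mathlib

open scoped TensorProduct

noncomputable section

namespace DoubleBosonisation

open Coalgebra HopfAlgebra

universe uk uH uB uC

/-- A quasitriangular structure on a Hopf algebra `H` over `k`: an invertible element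
`R` of `H ⊗ H` with `(Δ ⊗ id) R = R₁₃ R₂₃`, `(id ⊗ Δ) R = R₁₃ R₁₂` and
`τ (Δ h) = R (Δ h) R⁻¹`. -/
structure QuasitriangularStructure (k : Type uk) (H : Type uH) [Field k] [Ring H]
    [HopfAlgebra k H] where
  /-- the universal R-matrix, as a unit of the algebra `H ⊗ H` -/
  R : (H ⊗[k] H)ˣ
  comul_left :
    TensorProduct.assoc k H H H ((comul (R := k) (A := H)).rTensor H (R : H ⊗[k] H)) =
      (Algebra.TensorProduct.includeRight (R := k) (A := H) (B := H)).toLinearMap.lTensor H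
          (R : H ⊗[k] H) * ((1 : H) ⊗ₜ[k] (R : H ⊗[k] H))
  comul_right :
    (comul (R := k) (A := H)).lTensor H (R : H ⊗[k] H) =
      (Algebra.TensorProduct.includeRight (R := k) (A := H) (B := H)).toLinearMap.lTensor H
          (R : H ⊗[k] H) *
        (Algebra.TensorProduct.includeLeft (R := k) (S := k) (A := H)
          (B := H)).toLinearMap.lTensor H (R : H ⊗[k] H)
  comm_comul : ∀ h : H,
    TensorProduct.comm k H H (comul (R := k) h) =
      (R : H ⊗[k] H) * comul (R := k) h * ((R⁻¹ : (H ⊗[k] H)ˣ) : H ⊗[k] H)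

section Braiding

variable {k : Type uk} {H : Type uH} [Field k] [Ring H] [HopfAlgebra k H]
  {V W : Type*} [AddCommGroup V] [Module k V] [AddCommGroup W] [Module k W]

/-- The braiding `Ψ (v ⊗ w) = w ◁ R⁽¹⁾ ⊗ v ◁ R⁽²⁾` of right `H`-modules with actions
`α : (v, h) ↦ v ◁ h` and `β : (w, h) ↦ w ◁ h`. -/
def braiding (𝓡 : QuasitriangularStructure k H) (α : V →ₗ[k] H →ₗ[k] V)
    (β : W →ₗ[k] H →ₗ[k] W) : V ⊗[k] W →ₗ[k] W ⊗[k] V :=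
  (TensorProduct.map₂ β α).flip (𝓡.R : H ⊗[k] H) ∘ₗ (TensorProduct.comm k V W).toLinearMap

/-- Product of the braided tensor square of `B`:
`(b ⊗ c) ⊗ (d ⊗ e) ↦ b Ψ(c ⊗ d) e`. -/
def braidedTensorMul {B : Type uB} [Ring B] [Algebra k B]
    (𝓡 : QuasitriangularStructure k H) (α : B →ₗ[k] H →ₗ[k] B) :
    (B ⊗[k] B) ⊗[k] (B ⊗[k] B) →ₗ[k] B ⊗[k] B :=
  TensorProduct.map (LinearMap.mul' k B) (LinearMap.mul' k B) ∘ₗ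
    (TensorProduct.assoc k B B (B ⊗[k] B)).symm.toLinearMap ∘ₗ
    ((TensorProduct.assoc k B B B).toLinearMap ∘ₗ
      (braiding 𝓡 α α).rTensor B ∘ₗ
      (TensorProduct.assoc k B B B).symm.toLinearMap).lTensor B ∘ₗ
    (TensorProduct.assoc k B B (B ⊗[k] B)).toLinearMap

end Braiding

/-- A braided group (Hopf algebra) `B` in the braided category of right modules of the
quasitriangular Hopf algebra `(H, 𝓡)`.  The algebra and coalgebra structures of `B` are the
ambient instances; the coalgebra axioms are those of `Coalgebra`. -/
structure BraidedGroup {k : Type uk} {H : Type uH} [Field k] [Ring H] [HopfAlgebra k H]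
    (𝓡 : QuasitriangularStructure k H) (B : Type uB) [Ring B] [Algebra k B] [Coalgebra k B]
    where
  /-- the right action `act b h = b ◁ h` -/
  act : B →ₗ[k] H →ₗ[k] B
  act_one : ∀ b, act b 1 = b
  act_mul : ∀ b g h, act b (g * h) = act (act b g) h
  /-- the unit is `H`-invariant -/
  one_act : ∀ h, act 1 h = counit (R := k) h • (1 : B)
  /-- `(a b) ◁ h = (a ◁ h₁) (b ◁ h₂)` -/
  mul_act : ∀ a b h, act (a * b) h =
    LinearMap.mul' k B (TensorProduct.map₂ act act (a ⊗ₜ[k] b) (comul (R := k) h))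
  /-- `Δ (b ◁ h) = b₁ ◁ h₁ ⊗ b₂ ◁ h₂` -/
  comul_act : ∀ b h, comul (R := k) (act b h) =
    TensorProduct.map₂ act act (comul (R := k) b) (comul (R := k) h)
  counit_act : ∀ b h,
    counit (R := k) (act b h) = counit (R := k) b * counit (R := k) h
  comul_one : comul (R := k) (1 : B) = 1 ⊗ₜ[k] 1
  /-- the coproduct is multiplicative into the braided tensor square -/
  comul_mul : ∀ a b : B, comul (R := k) (a * b) =
    braidedTensorMul 𝓡 act (comul (R := k) a ⊗ₜ[k] comul (R := k) b)
  counit_one : counit (R := k) (1 : B) = 1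
  counit_mul : ∀ a b : B,
    counit (R := k) (a * b) = counit (R := k) a * counit (R := k) b
  /-- the braided antipode -/
  antipode : B →ₗ[k] B
  antipode_act : ∀ b h, antipode (act b h) = act (antipode b) h
  antipode_mul : ∀ b : B,
    LinearMap.mul' k B (antipode.rTensor B (comul (R := k) b)) =
      algebraMap k B (counit (R := k) b)
  mul_antipode : ∀ b : B,
    LinearMap.mul' k B (antipode.lTensor B (comul (R := k) b)) =
      algebraMap k B (counit (R := k) b)

/-- The input of the double bosonisation: a quasitriangular Hopf algebra `H`, braided groups
`B`, `C` in its category of right modules, a categorical duality pairing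
`ev : C ⊗ B → k`, and invertibility of the braided antipode of `C`. -/
structure Datum (k : Type uk) (H : Type uH) (B : Type uB) (C : Type uC) [Field k]
    [Ring H] [HopfAlgebra k H] [Ring B] [Algebra k B] [Coalgebra k B]
    [Ring C] [Algebra k C] [Coalgebra k C] where
  𝓡 : QuasitriangularStructure k H
  𝓑 : BraidedGroup 𝓡 B
  𝓒 : BraidedGroup 𝓡 C
  ev : C →ₗ[k] B →ₗ[k] k
  /-- `ev` is `H`-invariant: `ev (c ◁ h₁, b ◁ h₂) = ε(h) ev (c, b)` -/
  ev_act : ∀ c b h,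
    TensorProduct.lift ev (TensorProduct.map₂ 𝓒.act 𝓑.act (c ⊗ₜ[k] b) (comul (R := k) h)) =
      counit (R := k) h * ev c b
  /-- `ev (c d, b) = ev (d, b₁) ev (c, b₂)` -/
  ev_mul_left : ∀ c d b,
    ev (c * d) b = LinearMap.mul' k k (TensorProduct.map (ev d) (ev c) (comul (R := k) b))
  /-- `ev (c, a b) = ev (c₂, a) ev (c₁, b)` -/
  ev_mul_right : ∀ c a b,
    ev c (a * b) =
      LinearMap.mul' k k (TensorProduct.map (ev.flip b) (ev.flip a) (comul (R := k) c))
  ev_one_left : ∀ b, ev 1 b = counit (R := k) b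
  ev_one_right : ∀ c, ev c 1 = counit (R := k) c
  antipode_bijective : Function.Bijective 𝓒.antipode

/-- The data making an algebra `A` into a right module algebra of `U`, for the product `m`,
unit `e`, coproduct `δ` and counit `η` of `U`:
`v ◁ e = v`, `v ◁ (x y) = (v ◁ x) ◁ y`, `1 ◁ x = η(x) 1`,
`(v w) ◁ x = (v ◁ x₁) (w ◁ x₂)`. -/
structure IsRightModuleAlgebra {k U A : Type*} [Field k] [AddCommGroup U] [Module k U]
    [Ring A] [Algebra k A] (m : U →ₗ[k] U →ₗ[k] U) (e : U) (δ : U →ₗ[k] U ⊗[k] U)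
    (η : U →ₗ[k] k) (α : A →ₗ[k] U →ₗ[k] A) : Prop where
  act_one : ∀ v, α v e = v
  act_mul : ∀ v x y, α v (m x y) = α (α v x) y
  one_act : ∀ x, α 1 x = η x • (1 : A)
  mul_act : ∀ v w x,
    α (v * w) x = LinearMap.mul' k A (TensorProduct.map₂ α α (v ⊗ₜ[k] w) (δ x))

namespace Datum

variable {k : Type uk} {H : Type uH} {B : Type uB} {C : Type uC} [Field k]
  [Ring H] [HopfAlgebra k H] [Ring B] [Algebra k B] [Coalgebra k B]
  [Ring C] [Algebra k C] [Coalgebra k C] (X : Datum k H B C)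

/-- the R-matrix as an element of `H ⊗ H` -/
def R : H ⊗[k] H := (X.𝓡.R : H ⊗[k] H)

/-- `R⁻¹`, whose legs are written `R⁻⁽¹⁾ ⊗ R⁻⁽²⁾` -/
def Rinv : H ⊗[k] H := ((X.𝓡.R⁻¹ : (H ⊗[k] H)ˣ) : H ⊗[k] H)

/-! ### The braided group `C̄`

`D = C^{op/op}` has the opposite product, the flipped coproduct and the antipode of `C`, and the
left action `h ▷ c = c ◁ S h`.  Then `C̄ = D^{cop}` has the product of `D`, the coproduct
`Ψ⁻¹ ∘ Δ_D`, with `Ψ` the braiding of left modules, and the inverse antipode.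
The underlying space of `C̄` is that of `C`, so its unit and counit are those of `C`, and its
ordinary pairing `⟨c, b⟩` with `B` is `ev c b`. -/

/-- left action `barAct h c = h ▷ c = c ◁ S h` -/
def barAct : H →ₗ[k] C →ₗ[k] C := X.𝓒.act.flip ∘ₗ antipode k

/-- product of `C̄`: `barMul c d = d c`, computed in `C` -/
def barMul (_ : Datum k H B C) : C →ₗ[k] C →ₗ[k] C := (LinearMap.mul k C).flip

/-- inverse braiding of left modules on `D ⊗ D`: as `Ψ (v ⊗ w) = R⁽²⁾ ▷ w ⊗ R⁽¹⁾ ▷ v`, it is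
`Ψ⁻¹ (x ⊗ y) = R⁻⁽¹⁾ ▷ y ⊗ R⁻⁽²⁾ ▷ x` -/
def barBraidingInv : C ⊗[k] C →ₗ[k] C ⊗[k] C :=
  TensorProduct.map₂ X.barAct X.barAct X.Rinv ∘ₗ (TensorProduct.comm k C C).toLinearMap

/-- coproduct of `C̄`: the coproduct of `D` followed by `Ψ⁻¹` -/
def barComul : C →ₗ[k] C ⊗[k] C :=
  X.barBraidingInv ∘ₗ (TensorProduct.comm k C C).toLinearMap ∘ₗ comul

/-- antipode `S̄` of `C̄`: the inverse of the antipode of `C` -/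
def barAntipode : C →ₗ[k] C :=
  (LinearEquiv.ofBijective X.𝓒.antipode X.antipode_bijective).symm.toLinearMap

/-! ### The Hopf algebra `U(C̄, H, B)` on `C̄ ⊗ H ⊗ B` -/

/-- For a bilinear form `f` on `H` and `x, y ∈ H ⊗ H`, the element
`f(x⁽¹⁾, y⁽¹⁾) x⁽²⁾ ⊗ y⁽²⁾`. -/
def contract (_ : Datum k H B C) (x y : H ⊗[k] H) : (H →ₗ[k] H →ₗ[k] k) →ₗ[k] H ⊗[k] H where
  toFun f := TensorProduct.lid k (H ⊗[k] H)
    ((TensorProduct.lift f).rTensor (H ⊗[k] H)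
      (TensorProduct.tensorTensorTensorComm k H H H H (x ⊗ₜ[k] y)))
  map_add' f g := by
    have h : TensorProduct.lift (f + g) = TensorProduct.lift f + TensorProduct.lift g := by
      ext; simp
    rw [h, LinearMap.rTensor_add, LinearMap.add_apply, map_add]
  map_smul' r f := by
    have h : TensorProduct.lift (r • f) = r • TensorProduct.lift f := by
      ext; simp
    rw [h, LinearMap.rTensor_smul, LinearMap.smul_apply, map_smul, RingHom.id_apply]

/-- `pairAct c b` is the bilinear form `(h, g) ↦ ⟨h ▷ c, b ◁ g⟩` on `H` -/
def pairAct : C →ₗ[k] B →ₗ[k] (H →ₗ[k] H →ₗ[k] k) :=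
  LinearMap.mk₂ k (fun c b => X.ev.compl₁₂ (X.barAct.flip c) (X.𝓑.act b))
    (by intros; ext; simp) (by intros; ext; simp)
    (by intros; ext; simp) (by intros; ext; simp)

/-- `headPair c b = ⟨R₁⁽¹⁾ ▷ c, b ◁ R₂⁽¹⁾⟩ R₁⁽²⁾ ⊗ R₂⁽²⁾` -/
def headPair : C →ₗ[k] B →ₗ[k] H ⊗[k] H :=
  X.pairAct.compr₂ (X.contract X.R X.R)

/-- `tailPair c b = ⟨R₁⁻⁽²⁾ ▷ S̄ c, b ◁ R₂⁻⁽²⁾⟩ R₁⁻⁽¹⁾ ⊗ R₂⁻⁽¹⁾` -/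
def tailPair : C →ₗ[k] B →ₗ[k] H ⊗[k] H :=
  (X.pairAct.compr₂
    (X.contract (TensorProduct.comm k H H X.Rinv) (TensorProduct.comm k H H X.Rinv))) ∘ₗ
      X.barAntipode

/-- `(p ⊗ q) ⊗ (c ⊗ b) ⊗ (r ⊗ s) ↦ (p ▷ c) ⊗ (q r) ⊗ (b ◁ s)` -/
def crossAssemble :
    (H ⊗[k] H) ⊗[k] ((C ⊗[k] B) ⊗[k] (H ⊗[k] H)) →ₗ[k] C ⊗[k] (H ⊗[k] B) :=
  (TensorProduct.map (TensorProduct.lift X.barAct)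
      ((TensorProduct.map (LinearMap.mul' k H) (TensorProduct.lift X.𝓑.act)) ∘ₗ
        (TensorProduct.assoc k H H (B ⊗[k] H)).symm.toLinearMap ∘ₗ
        ((TensorProduct.leftComm k B H H).toLinearMap).lTensor H)) ∘ₗ
    (TensorProduct.tensorTensorTensorComm k H H C (B ⊗[k] (H ⊗[k] H))).toLinearMap ∘ₗ
    ((TensorProduct.assoc k C B (H ⊗[k] H)).toLinearMap).lTensor (H ⊗[k] H)

/-- The product `b c` of `b ∈ B` and `c ∈ C̄`, reordered into `C̄ ⊗ H ⊗ B`: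
`b c = (R₁⁽²⁾ ▷ c₂) ⊗ R₂⁽²⁾ R₁⁻⁽¹⁾ ⊗ (b₂ ◁ R₂⁻⁽¹⁾)
  ⟨R₁⁽¹⁾ ▷ c₁, b₁ ◁ R₂⁽¹⁾⟩ ⟨R₁⁻⁽²⁾ ▷ S̄ c₃, b₃ ◁ R₂⁻⁽²⁾⟩`,
where `c₁ ⊗ c₂ ⊗ c₃` is the iterated coproduct of `C̄`. -/
def cross : B →ₗ[k] C →ₗ[k] C ⊗[k] (H ⊗[k] B) :=
  (TensorProduct.curry
    (X.crossAssemble ∘ₗ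
      TensorProduct.map (TensorProduct.lift X.headPair)
        ((TensorProduct.lift X.tailPair).lTensor (C ⊗[k] B)) ∘ₗ
      ((TensorProduct.tensorTensorTensorComm k C C B B).toLinearMap).lTensor (C ⊗[k] B) ∘ₗ
      (TensorProduct.tensorTensorTensorComm k C (C ⊗[k] C) B (B ⊗[k] B)).toLinearMap ∘ₗ
      TensorProduct.map (X.barComul.lTensor C ∘ₗ X.barComul)
        ((comul (R := k) (A := B)).lTensor B ∘ₗ comul))).flip

/-- the product `(h ⊗ b) (g ⊗ a) = h g₁ ⊗ (b ◁ g₂) a` of the bosonisation of `B` on `H ⊗ B` -/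
def rbosMul : H ⊗[k] B →ₗ[k] H ⊗[k] B →ₗ[k] H ⊗[k] B :=
  LinearMap.flip (TensorProduct.lift (LinearMap.flip
    ((LinearMap.llcomp k (H ⊗[k] B) (H ⊗[k] B) (H ⊗[k] B) ∘ₗ
      (LinearMap.lTensorHom H ∘ₗ (LinearMap.mul k B).flip)).compl₂
        ((TensorProduct.map₂ (LinearMap.mul k H) X.𝓑.act).flip ∘ₗ comul))))

/-- left multiplication of `C̄ ⊗ H ⊗ B` by the bosonisation of `C̄` on `C̄ ⊗ H`:
`(c ⊗ h) · (d ⊗ g ⊗ b) = c (h₁ ▷ d) ⊗ h₂ g ⊗ b`, the product `c (h₁ ▷ d)` being that of `C̄` -/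
def lbosMul : C ⊗[k] H →ₗ[k] C ⊗[k] (H ⊗[k] B) →ₗ[k] C ⊗[k] (H ⊗[k] B) :=
  TensorProduct.lift
    ((LinearMap.llcomp k (C ⊗[k] (H ⊗[k] B)) (C ⊗[k] (H ⊗[k] B)) (C ⊗[k] (H ⊗[k] B)) ∘ₗ
      (LinearMap.rTensorHom (H ⊗[k] B) ∘ₗ X.barMul)).compl₂
        (TensorProduct.map₂ X.barAct (LinearMap.rTensorHom B ∘ₗ LinearMap.mul k H) ∘ₗ comul))

/-- left multiplication of `C̄ ⊗ H ⊗ B` by `B`: `b · (d ⊗ g ⊗ a) = Σ dᵢ ⊗ rᵢ g₁ ⊗ (bᵢ ◁ g₂) a`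
where `b d = Σ dᵢ ⊗ rᵢ ⊗ bᵢ` is the cross relation `cross b d` -/
def mulBU : B →ₗ[k] C ⊗[k] (H ⊗[k] B) →ₗ[k] C ⊗[k] (H ⊗[k] B) :=
  LinearMap.mk₂ k
    (fun b u => TensorProduct.lift ((LinearMap.lTensorHom C ∘ₗ X.rbosMul.flip).flip ∘ₗ
      X.cross b) u)
    (by intro b b' u; rw [← LinearMap.add_apply]; congr 1; ext; simp)
    (by intro r b u; rw [← LinearMap.smul_apply]; congr 1; ext; simp)
    (by intros; simp) (by intros; simp)

/-- The product of `U`: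
`(c ⊗ h ⊗ b) (d ⊗ g ⊗ a) = Σ c (h₁ ▷ dᵢ) ⊗ h₂ rᵢ g₁ ⊗ (bᵢ ◁ g₂) a`
where `b d = Σ dᵢ ⊗ rᵢ ⊗ bᵢ` is the cross relation `cross b d`. -/
def mul : C ⊗[k] (H ⊗[k] B) →ₗ[k] C ⊗[k] (H ⊗[k] B) →ₗ[k] C ⊗[k] (H ⊗[k] B) :=
  (TensorProduct.lift
    ((LinearMap.llcomp k (C ⊗[k] (H ⊗[k] B)) (C ⊗[k] (H ⊗[k] B)) (C ⊗[k] (H ⊗[k] B)) ∘ₗ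
      X.lbosMul).compl₂ X.mulBU)) ∘ₗ
    (TensorProduct.assoc k C H B).symm.toLinearMap

/-- the unit `1 ⊗ 1 ⊗ 1` of `U` -/
def one (_ : Datum k H B C) : C ⊗[k] (H ⊗[k] B) := 1 ⊗ₜ[k] (1 ⊗ₜ[k] 1)

/-- the tensor product coproduct
`c ⊗ h ⊗ b ↦ (c₁ ⊗ h₁ ⊗ b₁) ⊗ (c₂ ⊗ h₂ ⊗ b₂)`, with `c₁ ⊗ c₂` the coproduct of `C̄` -/
def tensorComul :
    C ⊗[k] (H ⊗[k] B) →ₗ[k] (C ⊗[k] (H ⊗[k] B)) ⊗[k] (C ⊗[k] (H ⊗[k] B)) :=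
  (TensorProduct.tensorTensorTensorComm k C C (H ⊗[k] B) (H ⊗[k] B)).toLinearMap ∘ₗ
    TensorProduct.map X.barComul
      ((TensorProduct.tensorTensorTensorComm k H H B B).toLinearMap ∘ₗ
        TensorProduct.map comul comul)

/-- The coproduct of `U`:
`Δ (c ⊗ h ⊗ b) = (c₁ ⊗ R⁻⁽¹⁾ h₁ ⊗ b₁ ◁ R⁽¹⁾) ⊗ (R⁻⁽²⁾ ▷ c₂ ⊗ h₂ R⁽²⁾ ⊗ b₂)`. -/
def comulU :
    C ⊗[k] (H ⊗[k] B) →ₗ[k] (C ⊗[k] (H ⊗[k] B)) ⊗[k] (C ⊗[k] (H ⊗[k] B)) :=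
  TensorProduct.map₂
      (LinearMap.lTensorHom C ∘ₗ LinearMap.rTensorHom B ∘ₗ LinearMap.mul k H)
      (LinearMap.rTensorHom (H ⊗[k] B) ∘ₗ X.barAct) X.Rinv ∘ₗ
    TensorProduct.map₂
      (LinearMap.lTensorHom C ∘ₗ LinearMap.lTensorHom H ∘ₗ X.𝓑.act.flip)
      (LinearMap.lTensorHom C ∘ₗ LinearMap.rTensorHom B ∘ₗ (LinearMap.mul k H).flip) X.R ∘ₗ
    X.tensorComul

/-- the counit `c ⊗ h ⊗ b ↦ ε(c) ε(h) ε(b)` of `U` -/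
def counitU (_ : Datum k H B C) : C ⊗[k] (H ⊗[k] B) →ₗ[k] k :=
  LinearMap.mul' k k ∘ₗ TensorProduct.map counit
    (LinearMap.mul' k k ∘ₗ TensorProduct.map counit counit)

/-! ### The fundamental representation -/

/-- The right braided adjoint action of `B` on itself:
`v ◁ b = (S b₁ ◁ R⁽¹⁾) (v ◁ R⁽²⁾) b₂`, i.e. `v` is braided past `S b₁` and the result is
multiplied by `b₂` on the right. -/
def adjointAct : B →ₗ[k] B →ₗ[k] B :=
  TensorProduct.curry
    (LinearMap.mul' k B ∘ₗ
      (LinearMap.mul' k B ∘ₗ braiding X.𝓡 X.𝓑.act X.𝓑.act ∘ₗ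
        X.𝓑.antipode.lTensor B).rTensor B ∘ₗ
      (TensorProduct.assoc k B B B).symm.toLinearMap ∘ₗ
      (comul (R := k) (A := B)).lTensor B)

/-- The coregular action of `C̄` on `B` (braided differentiation):
`v ◁ c = ⟨S̄ c, v₂ ◁ R⁻⁽²⁾⟩ v₁ ◁ R⁻⁽¹⁾`. -/
def coregularAct (v : B) (c : C) : B :=
  TensorProduct.rid k B
    ((X.ev (X.barAntipode c)).lTensor B
      (TensorProduct.map₂ X.𝓑.act X.𝓑.act (comul (R := k) v) X.Rinv))

end Datum

end DoubleBosonisation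

end

/-! In `U` the element c ⊗ h ⊗ b is the product c · h · b of its factors (`mul_decompose`), so the
prescribed actions force v ◁ (c ⊗ h ⊗ b) = ((v ◁ c) ◁ h) ◁ b. This gives uniqueness and leaves a
single candidate, `fundamental`; existence means that this candidate respects the product, unit,
coproduct and counit of `U`.

For the product: C̄ and B each act on their own (`coregularAct_barMul`, `adjointAct_mul`), and H
moves past both covariantly (`coregularAct_act`, `act_adjointAct`). By `fundamental_lbosMul` it then
suffices to move b ∈ B past d ∈ C̄, that is, to show (v ◁ b) ◁ d = v ◁ (b d) with b d written in
normal order (`fundamental_cross`). Up to braiding, v ◁ b is the product S b₁ · v · b₂, to which d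
is applied by the braided Leibniz rule (`mul_coregularAct`). Differentiating the antipode pairs d₁
with the first part of b (`coregular_antipode`), differentiating the last factor pairs S̄ d₃ with
the last part of b, and d₂ differentiates v: these are the ingredients of the cross relation. The
invariance of the pairing moves every R-matrix leg from C̄ to B. The two sides then differ only in
the elements of H acting on b₁, S b₂, b₃, b₄, v₁, v₂, and their equality is an identity in the sixth
tensor power of H (`leg_cross`, `sw_cross`), which follows from the hexagon and Yang-Baxter
equations.

For the coproduct: the Leibniz rules `mul_coregularAct` and `mul_adjointAct` carry exactly the R⁻¹
and the R in the coproduct of `U` (`mul_fundamental`). -/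

noncomputable section

namespace DoubleBosonisation

open Coalgebra HopfAlgebra

set_option linter.unusedSectionVars false
set_option synthInstance.maxSize 4000
set_option synthInstance.maxHeartbeats 400000

/-! ### Sweedler sums

`sw t f` is the sum of `f x y` over a decomposition `t = Σ x ⊗ y` into pure tensors.  Linearity of
the functions summed is found by instance search, through the class `Lin`. -/

section Sweedler

variable {k : Type*} [CommSemiring k]
  {V W P Q M N A : Type*} [AddCommMonoid V] [Module k V] [AddCommMonoid W] [Module k W]
  [AddCommMonoid P] [Module k P] [AddCommMonoid Q] [Module k Q]
  [AddCommMonoid M] [Module k M] [AddCommMonoid N] [Module k N] [Semiring A] [Algebra k A]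

/-- `f` is linear -/
class Lin (k : Type*) [CommSemiring k] {V M : Type*} [AddCommMonoid V] [Module k V]
    [AddCommMonoid M] [Module k M] (f : V → M) : Prop where
  map_add' : ∀ x y, f (x + y) = f x + f y
  map_smul' : ∀ (r : k) x, f (r • x) = r • f x

/-- the linear map underlying a function which is known to be linear -/
def lin (f : V → M) [h : Lin k f] : V →ₗ[k] M where
  toFun := f
  map_add' := h.map_add'
  map_smul' := h.map_smul'

/-- the linear map on `V ⊗ W` underlying a bilinear function -/
def bilin (f : V → W → M) [h₁ : ∀ y, Lin k fun x => f x y] [h₂ : ∀ x, Lin k fun y => f x y] :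
    V ⊗[k] W →ₗ[k] M :=
  TensorProduct.lift (LinearMap.mk₂ k f (fun x x' y => (h₁ y).map_add' x x')
    (fun r x y => (h₁ y).map_smul' r x) (fun x y y' => (h₂ x).map_add' y y')
    (fun r x y => (h₂ x).map_smul' r y))

/-- `Σ f x y` over a decomposition `t = Σ x ⊗ y` -/
def sw (t : V ⊗[k] W) (f : V → W → M) : M :=
  ∑ p ∈ (TensorProduct.exists_finset t).choose, f p.1 p.2

@[simp] lemma lin_apply (f : V → M) [Lin k f] (x : V) : lin (k := k) f x = f x := rfl

@[simp] lemma bilin_tmul (f : V → W → M) [∀ y, Lin k fun x => f x y]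
    [∀ x, Lin k fun y => f x y] (x : V) (y : W) : bilin (k := k) f (x ⊗ₜ y) = f x y := rfl

lemma map_eq_sw (φ : V ⊗[k] W →ₗ[k] M) (t : V ⊗[k] W) :
    φ t = sw t fun x y => φ (x ⊗ₜ y) := by
  conv_lhs => rw [(TensorProduct.exists_finset t).choose_spec]
  rw [map_sum]; rfl

/-- The decomposition in `sw` is an arbitrary choice; for bilinear summands the sum does not depend
on it. Every lemma below that changes the tensor being decomposed passes through this one, whereas
those that only rearrange finite sums need no linearity. -/
lemma bilin_eq_sw (f : V → W → M) [∀ y, Lin k fun x => f x y] [∀ x, Lin k fun y => f x y]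
    (t : V ⊗[k] W) : bilin f t = sw t f := by
  rw [map_eq_sw]; rfl

lemma sw_tmul_self (t : V ⊗[k] W) : (sw t fun x y => x ⊗ₜ[k] y) = t :=
  (map_eq_sw LinearMap.id t).symm

instance lin_id : Lin k fun x : V => x := ⟨fun _ _ => rfl, fun _ _ => rfl⟩

instance lin_coe (φ : V →ₗ[k] M) : Lin k (fun x => φ x) := ⟨φ.map_add, φ.map_smul⟩

instance lin_map (φ : W →ₗ[k] M) (f : V → W) [h : Lin k f] : Lin k fun x => φ (f x) :=
  ⟨fun x y => by rw [h.map_add', map_add], fun r x => by rw [h.map_smul', map_smul]⟩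

instance lin_coe_algHom {A' : Type*} [Semiring A'] [Algebra k A'] (φ : A →ₐ[k] A') :
    Lin k (fun x => φ x) := ⟨map_add φ, map_smul φ⟩

instance lin_mul_const (a : A) : Lin k (HMul.hMul a) :=
  ⟨fun x y => mul_add a x y, fun r x => mul_smul_comm r a x⟩

instance lin_tmul_const (a : M) : Lin k (TensorProduct.tmul k a : N → M ⊗[k] N) :=
  ⟨TensorProduct.tmul_add a, fun r x => TensorProduct.tmul_smul r a x⟩

instance lin_smul_const (a : k) : Lin k (HSMul.hSMul a : M → M) :=
  ⟨smul_add a, fun r x => smul_comm a r x⟩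

instance lin_map₂ (φ : W →ₗ[k] P →ₗ[k] M) (f : V → W) (y : P) [h : Lin k f] :
    Lin k fun x => φ (f x) y :=
  ⟨fun x y => by rw [h.map_add', map_add, LinearMap.add_apply],
    fun r x => by rw [h.map_smul', map_smul, LinearMap.smul_apply]⟩

instance lin_mul_left (f : V → A) (a : A) [h : Lin k f] : Lin k fun x => f x * a :=
  ⟨fun x y => by rw [h.map_add', add_mul], fun r x => by rw [h.map_smul', smul_mul_assoc]⟩

instance lin_mul_right (f : V → A) (a : A) [h : Lin k f] : Lin k fun x => a * f x :=
  ⟨fun x y => by rw [h.map_add', mul_add], fun r x => by rw [h.map_smul', mul_smul_comm]⟩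

instance lin_smul_left (f : V → k) (a : M) [h : Lin k f] : Lin k fun x => f x • a :=
  ⟨fun x y => by rw [h.map_add', add_smul], fun r x => by rw [h.map_smul', smul_assoc]⟩

instance lin_smul_right (f : V → M) (a : k) [h : Lin k f] : Lin k fun x => a • f x :=
  ⟨fun x y => by rw [h.map_add', smul_add], fun r x => by rw [h.map_smul', smul_comm]⟩

instance lin_tmul_left (f : V → M) (a : N) [h : Lin k f] : Lin k fun x => f x ⊗ₜ[k] a :=
  ⟨fun x y => by rw [h.map_add', TensorProduct.add_tmul],
    fun r x => by rw [h.map_smul', TensorProduct.smul_tmul']⟩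

instance lin_tmul_right (f : V → M) (a : N) [h : Lin k f] : Lin k fun x => a ⊗ₜ[k] f x :=
  ⟨fun x y => by rw [h.map_add', TensorProduct.tmul_add],
    fun r x => by rw [h.map_smul', TensorProduct.tmul_smul]⟩

instance lin_sw_right (t : P ⊗[k] Q) (f : V → P → Q → M) [h : ∀ p q, Lin k fun x => f x p q] :
    Lin k fun x => sw t (f x) :=
  ⟨fun x y => by simp only [sw, (h _ _).map_add', Finset.sum_add_distrib],
    fun r x => by simp only [sw, (h _ _).map_smul', Finset.smul_sum]⟩

/-- The decomposition chosen for t (x + y) is unrelated to those chosen for t x and t y, so here,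
unlike in `lin_sw_right`, the summand must be bilinear. -/
instance lin_sw_left (t : V → P ⊗[k] Q) (f : P → Q → M) [h : Lin k t]
    [∀ y, Lin k fun x => f x y] [∀ x, Lin k fun y => f x y] : Lin k fun x => sw (t x) f :=
  ⟨fun x y => by simp only [← bilin_eq_sw, h.map_add', map_add],
    fun r x => by simp only [← bilin_eq_sw, h.map_smul', map_smul]⟩

lemma sw_tmul (f : V → W → M) [∀ y, Lin k fun x => f x y] [∀ x, Lin k fun y => f x y]
    (x : V) (y : W) : sw (x ⊗ₜ[k] y) f = f x y := by
  rw [← bilin_eq_sw, bilin_tmul]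

lemma sw_smul (f : V → W → M) [∀ y, Lin k fun x => f x y] [∀ x, Lin k fun y => f x y]
    (r : k) (t : V ⊗[k] W) : sw (r • t) f = r • sw t f := by
  simp only [← bilin_eq_sw, map_smul]

/-- decomposing a tensor which is itself a Sweedler sum -/
lemma sw_sw (t : V ⊗[k] W) (g : V → W → P ⊗[k] Q) (f : P → Q → M)
    [∀ y, Lin k fun x => f x y] [∀ x, Lin k fun y => f x y] :
    sw (sw t g) f = sw t fun x y => sw (g x y) f := by
  simp only [← bilin_eq_sw]
  simp only [sw, map_sum]

lemma sw_comm (t : V ⊗[k] W) (s : P ⊗[k] Q) (f : V → W → P → Q → M) :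
    (sw t fun x y => sw s fun p q => f x y p q) = sw s fun p q => sw t fun x y => f x y p q :=
  Finset.sum_comm

lemma map_sw {F : Type*} [FunLike F M N] [AddMonoidHomClass F M N] (φ : F) (t : V ⊗[k] W)
    (f : V → W → M) : φ (sw t f) = sw t fun x y => φ (f x y) := by
  simp only [sw, map_sum]

lemma map_sw_apply (φ : M →ₗ[k] P →ₗ[k] N) (t : V ⊗[k] W) (f : V → W → M) (p : P) :
    φ (sw t f) p = sw t fun x y => φ (f x y) p := by
  simp only [sw, map_sum, LinearMap.sum_apply]

lemma sw_apply (t : V ⊗[k] W) (f : V → W → P →ₗ[k] N) (p : P) :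
    sw t f p = sw t fun x y => f x y p := by
  simp only [sw, LinearMap.sum_apply]

lemma sw_mul (t : V ⊗[k] W) (f : V → W → A) (a : A) :
    sw t f * a = sw t fun x y => f x y * a := by
  simp only [sw, Finset.sum_mul]

lemma mul_sw (t : V ⊗[k] W) (f : V → W → A) (a : A) :
    a * sw t f = sw t fun x y => a * f x y := by
  simp only [sw, Finset.mul_sum]

lemma smul_sw (t : V ⊗[k] W) (f : V → W → M) (a : k) :
    a • sw t f = sw t fun x y => a • f x y := by
  simp only [sw, Finset.smul_sum]

lemma sw_smul_left (t : V ⊗[k] W) (f : V → W → k) (a : M) :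
    sw t f • a = sw t fun x y => f x y • a := by
  simp only [sw, Finset.sum_smul]

lemma sw_tmul_left (t : V ⊗[k] W) (f : V → W → M) (a : N) :
    sw t f ⊗ₜ[k] a = sw t fun x y => f x y ⊗ₜ[k] a := by
  simp only [sw, TensorProduct.sum_tmul]

lemma sw_tmul_right (t : V ⊗[k] W) (f : V → W → M) (a : N) :
    a ⊗ₜ[k] sw t f = sw t fun x y => a ⊗ₜ[k] f x y := by
  simp only [sw, TensorProduct.tmul_sum]

lemma sw_congr {t : V ⊗[k] W} {f g : V → W → M} (h : ∀ x y, f x y = g x y) :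
    sw t f = sw t g := by
  simp only [sw, h]

/-- a trilinear function on the iterated tensor product -/
lemma bilin_lTensor (f : V → P → Q → M) [∀ y z, Lin k fun x => f x y z]
    [∀ x z, Lin k fun y => f x y z] [∀ x y, Lin k fun z => f x y z]
    (t : V ⊗[k] W) (φ : W →ₗ[k] P ⊗[k] Q) :
    bilin (fun x s => sw s (f x)) (φ.lTensor V t) = sw t fun x y => sw (φ y) (f x) := by
  rw [map_eq_sw (LinearMap.lTensor V φ)]
  simp only [map_sw, LinearMap.lTensor_tmul, bilin_tmul]

/-- a trilinear function on the iterated tensor product, associated the other way -/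
lemma bilin_rTensor (f : P → Q → W → M) [∀ y z, Lin k fun x => f x y z]
    [∀ x z, Lin k fun y => f x y z] [∀ x y, Lin k fun z => f x y z]
    (t : V ⊗[k] W) (φ : V →ₗ[k] P ⊗[k] Q) :
    bilin (fun x s => sw s (f x)) (TensorProduct.assoc k P Q W (φ.rTensor W t)) =
      sw t fun x y => sw (φ x) fun p q => f p q y := by
  rw [map_eq_sw (LinearMap.rTensor W φ)]
  simp only [map_sw, LinearMap.rTensor_tmul]
  refine sw_congr fun x y => ?_
  have h : φ x ⊗ₜ[k] y = sw (φ x) fun p q => (p ⊗ₜ[k] q) ⊗ₜ[k] y := by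
    rw [← sw_tmul_left, sw_tmul_self]
  rw [h]
  simp only [map_sw, TensorProduct.assoc_tmul, bilin_tmul, sw_tmul]

end Sweedler

/-! ### Coassociativity and counit in Sweedler form. -/

section Coalgebra

variable {k : Type*} [CommSemiring k] {B M : Type*} [AddCommMonoid B] [Module k B] [Coalgebra k B]
  [AddCommMonoid M] [Module k M]

lemma sw_coassoc (b : B) (f : B → B → B → M) [∀ y z, Lin k fun x => f x y z]
    [∀ x z, Lin k fun y => f x y z] [∀ x y, Lin k fun z => f x y z] :
    (sw (comul (R := k) b) fun x y => sw (comul (R := k) x) fun p q => f p q y) =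
      sw (comul (R := k) b) fun x y => sw (comul (R := k) y) fun p q => f x p q := by
  rw [← bilin_lTensor, ← bilin_rTensor, coassoc_apply]

lemma sw_counit_left (b : B) (f : B → M) [Lin k f] :
    (sw (comul (R := k) b) fun x y => counit (R := k) x • f y) = f b := by
  have h := congrArg ((TensorProduct.lid k M).toLinearMap ∘ₗ (lin f).lTensor k)
    (rTensor_counit_comul (R := k) b)
  rw [map_eq_sw ((counit (R := k)).rTensor B)] at h
  simpa [map_sw] using h

lemma sw_counit_right (b : B) (f : B → M) [Lin k f] :
    (sw (comul (R := k) b) fun x y => counit (R := k) y • f x) = f b := by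
  have h := congrArg ((TensorProduct.rid k M).toLinearMap ∘ₗ (lin f).rTensor k)
    (lTensor_counit_comul (R := k) b)
  rw [map_eq_sw ((counit (R := k)).lTensor B)] at h
  simpa [map_sw] using h

end Coalgebra

/-! ### The R-matrix, its inverse and the hexagon identities. -/

namespace QuasitriangularStructure

variable {k : Type*} {H : Type*} [Field k] [Ring H] [HopfAlgebra k H]
  {M : Type*} [AddCommMonoid M] [Module k M]
  (𝓡 : QuasitriangularStructure k H)

/-- the R-matrix as an element of `H ⊗ H` -/
def mat : H ⊗[k] H := (𝓡.R : H ⊗[k] H)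

/-- the inverse of the R-matrix -/
def inv : H ⊗[k] H := ((𝓡.R⁻¹ : (H ⊗[k] H)ˣ) : H ⊗[k] H)

lemma mat_mul_inv : 𝓡.mat * 𝓡.inv = 1 := 𝓡.R.mul_inv

lemma inv_mul_mat : 𝓡.inv * 𝓡.mat = 1 := 𝓡.R.inv_mul

lemma sw_mul_tensor (s t : H ⊗[k] H) (f : H → H → M) [∀ y, Lin k fun x => f x y]
    [∀ x, Lin k fun y => f x y] :
    sw (s * t) f = sw s fun x y => sw t fun p q => f (x * p) (y * q) := by
  conv_lhs => rw [← sw_tmul_self s, ← sw_tmul_self t]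
  simp only [sw_mul, mul_sw, Algebra.TensorProduct.tmul_mul_tmul]
  simp only [sw_sw, sw_tmul]
  rw [sw_comm]

lemma sw_mat_inv (f : H → H → M) [∀ y, Lin k fun x => f x y] [∀ x, Lin k fun y => f x y] :
    (sw 𝓡.mat fun x y => sw 𝓡.inv fun p q => f (x * p) (y * q)) = f 1 1 := by
  rw [← sw_mul_tensor, mat_mul_inv, Algebra.TensorProduct.one_def, sw_tmul]

lemma sw_inv_mat (f : H → H → M) [∀ y, Lin k fun x => f x y] [∀ x, Lin k fun y => f x y] :
    (sw 𝓡.inv fun x y => sw 𝓡.mat fun p q => f (x * p) (y * q)) = f 1 1 := by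
  rw [← sw_mul_tensor, inv_mul_mat, Algebra.TensorProduct.one_def, sw_tmul]

section Legs

/-! ### Copies of the R-matrix in the legs of an algebra -/

variable {A : Type*} [Ring A] [Algebra k A] {i j l m : H →ₐ[k] A}

/-- the image of `t` under `x ⊗ y ↦ i x * j y` -/
def leg (t : H ⊗[k] H) (i j : H →ₐ[k] A) : A := sw t fun x y => i x * j y

/-- Commuting legs turn x ⊗ y ↦ i x * j y into an algebra map on H ⊗ H, so identities between R and
R⁻¹ transfer to any algebra `A`. -/
lemma leg_eq (t : H ⊗[k] H) (h : ∀ x y, Commute (i x) (j y)) :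
    leg t i j = Algebra.TensorProduct.lift i j h t := by
  have := map_eq_sw (Algebra.TensorProduct.lift i j h).toLinearMap t
  simpa [leg] using this.symm

lemma leg_mat_inv (h : ∀ x y, Commute (i x) (j y)) : leg 𝓡.mat i j * leg 𝓡.inv i j = 1 := by
  rw [leg_eq _ h, leg_eq _ h, ← map_mul, mat_mul_inv, map_one]

lemma leg_inv_mat (h : ∀ x y, Commute (i x) (j y)) : leg 𝓡.inv i j * leg 𝓡.mat i j = 1 := by
  rw [leg_eq _ h, leg_eq _ h, ← map_mul, inv_mul_mat, map_one]

lemma leg_commute (s t : H ⊗[k] H) (h₁ : ∀ x y, Commute (i x) (l y))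
    (h₂ : ∀ x y, Commute (i x) (m y)) (h₃ : ∀ x y, Commute (j x) (l y))
    (h₄ : ∀ x y, Commute (j x) (m y)) : leg s i j * leg t l m = leg t l m * leg s i j := by
  simp only [leg, sw_mul, mul_sw]
  rw [sw_comm]
  refine sw_congr fun x y => sw_congr fun p q => ?_
  exact ((h₁ _ _).mul_right (h₂ _ _)).mul_left ((h₃ _ _).mul_right (h₄ _ _))

end Legs

lemma sw_mat_comul_left (f : H → H → H → M) [∀ y z, Lin k fun x => f x y z]
    [∀ x z, Lin k fun y => f x y z] [∀ x y, Lin k fun z => f x y z] :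
    (sw 𝓡.mat fun r s => sw (comul (R := k) r) fun x y => f x y s) =
      sw 𝓡.mat fun r s => sw 𝓡.mat fun r' s' => f r r' (s * s') := by
  rw [← bilin_rTensor, mat, 𝓡.comul_left, map_eq_sw (LinearMap.lTensor _ _)]
  simp only [LinearMap.lTensor_tmul, sw_mul, map_sw]
  refine sw_congr fun r s => ?_
  conv_lhs => rw [← sw_tmul_self (𝓡.R : H ⊗[k] H)]
  simp only [sw_tmul_right, mul_sw, map_sw]
  simp [sw_tmul]

lemma sw_mat_comul_right (f : H → H → H → M) [∀ y z, Lin k fun x => f x y z]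
    [∀ x z, Lin k fun y => f x y z] [∀ x y, Lin k fun z => f x y z] :
    (sw 𝓡.mat fun r s => sw (comul (R := k) s) fun x y => f r x y) =
      sw 𝓡.mat fun r s => sw 𝓡.mat fun r' s' => f (r * r') s' s := by
  rw [← bilin_lTensor, mat, 𝓡.comul_right, map_eq_sw (LinearMap.lTensor H
    (Algebra.TensorProduct.includeRight).toLinearMap), map_eq_sw (LinearMap.lTensor H
    (Algebra.TensorProduct.includeLeft).toLinearMap)]
  simp only [LinearMap.lTensor_tmul, sw_mul, mul_sw, map_sw]
  rw [sw_comm]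
  simp [sw_tmul]

end QuasitriangularStructure

/-! ### Yang-Baxter equation, and R under the counit and the antipode. -/

namespace QuasitriangularStructure

variable {k : Type*} {H : Type*} [Field k] [Ring H] [HopfAlgebra k H]
  {M : Type*} [AddCommMonoid M] [Module k M]
  (𝓡 : QuasitriangularStructure k H)

lemma sw_comm_tensor (f : H → H → M) [∀ y, Lin k fun x => f x y]
    [∀ x, Lin k fun y => f x y] (t : H ⊗[k] H) :
    sw (TensorProduct.comm k H H t) f = sw t fun x y => f y x := by
  conv_lhs => rw [← sw_tmul_self t]
  simp only [map_sw, TensorProduct.comm_tmul, sw_sw, sw_tmul]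

section Legs

variable {A : Type*} [Ring A] [Algebra k A] {i j l : H →ₐ[k] A}

/-- the diagonal copy `h ↦ i h₁ * j h₂` of `H` -/
def diag (i j : H →ₐ[k] A) (h : ∀ x y, Commute (i x) (j y)) : H →ₐ[k] A :=
  (Algebra.TensorProduct.lift i j h).comp (Bialgebra.comulAlgHom k H)

lemma diag_apply (h : ∀ x y, Commute (i x) (j y)) (x : H) :
    diag i j h x = sw (comul (R := k) x) fun p q => i p * j q :=
  (leg_eq _ h).symm

lemma diag_commute_left (h : ∀ x y, Commute (i x) (j y)) (h₁ : ∀ x y, Commute (i x) (l y))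
    (h₂ : ∀ x y, Commute (j x) (l y)) (x y : H) : Commute (diag i j h x) (l y) := by
  rw [diag_apply]
  simp only [Commute, SemiconjBy, sw_mul, mul_sw]
  exact sw_congr fun p q => (h₁ p y).mul_left (h₂ q y)

lemma diag_commute_right (h : ∀ x y, Commute (j x) (l y)) (h₁ : ∀ x y, Commute (i x) (j y))
    (h₂ : ∀ x y, Commute (i x) (l y)) (x y : H) : Commute (i x) (diag j l h y) :=
  (diag_commute_left h (fun x y => (h₁ y x).symm) (fun x y => (h₂ y x).symm) y x).symm

lemma leg_mat_diag_left (h : ∀ x y, Commute (i x) (j y)) (h₂ : ∀ x y, Commute (j x) (l y)) :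
    leg 𝓡.mat (diag i j h) l = leg 𝓡.mat i l * leg 𝓡.mat j l := by
  simp only [leg, diag_apply, sw_mul, mul_sw]
  rw [sw_mat_comul_left 𝓡 fun x y s => i x * j y * l s, sw_comm]
  refine sw_congr fun r' s' => sw_congr fun r s => ?_
  rw [map_mul, mul_assoc, ← mul_assoc (j r'), (h₂ r' s).eq]
  simp only [mul_assoc]

lemma leg_mat_diag_right (h : ∀ x y, Commute (j x) (l y)) (h₂ : ∀ x y, Commute (i x) (l y)) :
    leg 𝓡.mat i (diag j l h) = leg 𝓡.mat i l * leg 𝓡.mat i j := by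
  simp only [leg, diag_apply, sw_mul, mul_sw]
  rw [sw_mat_comul_right 𝓡 fun x y s => i x * (j y * l s), sw_comm]
  refine sw_congr fun r' s' => sw_congr fun r s => ?_
  rw [map_mul, (h s' s).eq, mul_assoc, ← mul_assoc (i r'), (h₂ r' s).eq]
  simp only [mul_assoc]

/-- Inverts the hexagon R₁₃ R₂₃; the order of the factors is reversed, and uniqueness of inverses
does the rest. -/
lemma leg_inv_diag_left (h : ∀ x y, Commute (i x) (j y)) (h₁ : ∀ x y, Commute (i x) (l y))
    (h₂ : ∀ x y, Commute (j x) (l y)) :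
    leg 𝓡.inv (diag i j h) l = leg 𝓡.inv j l * leg 𝓡.inv i l := by
  refine left_inv_eq_right_inv (leg_inv_mat 𝓡 (diag_commute_left h h₁ h₂)) ?_
  rw [leg_mat_diag_left 𝓡 h h₂, mul_assoc, ← mul_assoc _ (leg 𝓡.inv j l), leg_mat_inv 𝓡 h₂,
    one_mul, leg_mat_inv 𝓡 h₁]

lemma leg_inv_diag_right (h : ∀ x y, Commute (j x) (l y)) (h₁ : ∀ x y, Commute (i x) (j y))
    (h₂ : ∀ x y, Commute (i x) (l y)) :
    leg 𝓡.inv i (diag j l h) = leg 𝓡.inv i j * leg 𝓡.inv i l := by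
  refine left_inv_eq_right_inv (leg_inv_mat 𝓡 (diag_commute_right h h₁ h₂)) ?_
  rw [leg_mat_diag_right 𝓡 h h₂, mul_assoc, ← mul_assoc _ (leg 𝓡.inv i j), leg_mat_inv 𝓡 h₁,
    one_mul, leg_mat_inv 𝓡 h₂]

lemma sw_inv_comul_left_mul (h : ∀ x y, Commute (i x) (j y)) (h₁ : ∀ x y, Commute (i x) (l y))
    (h₂ : ∀ x y, Commute (j x) (l y)) :
    (sw 𝓡.inv fun r s => sw (comul (R := k) r) fun x y => i x * j y * l s) =
      leg 𝓡.inv j l * leg 𝓡.inv i l := by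
  rw [← leg_inv_diag_left 𝓡 h h₁ h₂]
  simp only [leg, diag_apply, sw_mul]

lemma sw_inv_comul_right_mul (h : ∀ x y, Commute (j x) (l y)) (h₁ : ∀ x y, Commute (i x) (j y))
    (h₂ : ∀ x y, Commute (i x) (l y)) :
    (sw 𝓡.inv fun r s => sw (comul (R := k) s) fun x y => i r * (j x * l y)) =
      leg 𝓡.inv i j * leg 𝓡.inv i l := by
  rw [← leg_inv_diag_right 𝓡 h h₁ h₂]
  simp only [leg, diag_apply, mul_sw]

lemma mat_mul_comul (x : H) :
    𝓡.mat * comul (R := k) x = TensorProduct.comm k H H (comul (R := k) x) * 𝓡.mat := by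
  rw [𝓡.comm_comul, mul_assoc]
  change _ = _ * (𝓡.inv * 𝓡.mat)
  rw [inv_mul_mat, mul_one]
  rfl

lemma comul_mul_inv (x : H) :
    comul (R := k) x * 𝓡.inv = 𝓡.inv * TensorProduct.comm k H H (comul (R := k) x) := by
  rw [𝓡.comm_comul]
  change _ = 𝓡.inv * (𝓡.mat * _ * 𝓡.inv)
  rw [← mul_assoc, ← mul_assoc, inv_mul_mat, one_mul]

lemma leg_mat_mul_diag (h : ∀ x y, Commute (i x) (j y)) (x : H) :
    leg 𝓡.mat i j * diag i j h x = diag j i (fun x y => (h y x).symm) x * leg 𝓡.mat i j := by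
  have e : diag j i (fun x y => (h y x).symm) x =
      leg (TensorProduct.comm k H H (comul (R := k) x)) i j := by
    rw [diag_apply, leg, sw_comm_tensor]
    exact sw_congr fun p q => (h q p).eq.symm
  rw [e, leg_eq _ h, leg_eq _ h, diag, AlgHom.comp_apply, ← map_mul, ← map_mul]
  exact congrArg _ (mat_mul_comul 𝓡 x)

lemma leg_mat_mul_leg_diag (t : H ⊗[k] H) (h : ∀ x y, Commute (i x) (j y))
    (h₁ : ∀ x y, Commute (i x) (l y)) (h₂ : ∀ x y, Commute (j x) (l y)) :
    leg 𝓡.mat i j * leg t (diag i j h) l =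
      leg t (diag j i (fun x y => (h y x).symm)) l * leg 𝓡.mat i j := by
  change leg 𝓡.mat i j * (sw t fun x y => diag i j h x * l y) =
    (sw t fun x y => diag j i (fun x y => (h y x).symm) x * l y) * leg 𝓡.mat i j
  rw [mul_sw, sw_mul]
  refine sw_congr fun x y => ?_
  rw [← mul_assoc, leg_mat_mul_diag, mul_assoc, mul_assoc]
  congr 1
  simp only [leg, mul_sw, sw_mul]
  exact sw_congr fun p q => ((h₁ p y).mul_left (h₂ q y)).eq

/-- the Yang-Baxter equation -/
lemma yang_baxter (h : ∀ x y, Commute (i x) (j y)) (h₁ : ∀ x y, Commute (i x) (l y))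
    (h₂ : ∀ x y, Commute (j x) (l y)) :
    leg 𝓡.mat i j * leg 𝓡.mat i l * leg 𝓡.mat j l =
      leg 𝓡.mat j l * leg 𝓡.mat i l * leg 𝓡.mat i j := by
  -- The hexagon fuses R_il R_jl into one R whose first leg is diagonal in i and j; conjugating by
  -- R_ij flips that diagonal.
  rw [mul_assoc, ← leg_mat_diag_left 𝓡 h h₂, ← leg_mat_diag_left 𝓡 (fun x y => (h y x).symm) h₁,
    leg_mat_mul_leg_diag 𝓡 _ h h₁ h₂]

end Legs

section Triple

/-- the legs of `H ⊗ H ⊗ H` -/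
def tripleFst : H →ₐ[k] H ⊗[k] (H ⊗[k] H) := Algebra.TensorProduct.includeLeft

/-- the legs of `H ⊗ H ⊗ H` -/
def tripleSnd : H →ₐ[k] H ⊗[k] (H ⊗[k] H) :=
  Algebra.TensorProduct.includeRight.comp Algebra.TensorProduct.includeLeft

/-- the legs of `H ⊗ H ⊗ H` -/
def tripleThd : H →ₐ[k] H ⊗[k] (H ⊗[k] H) :=
  Algebra.TensorProduct.includeRight.comp Algebra.TensorProduct.includeRight

lemma tripleFst_apply (x : H) : tripleFst (k := k) x = x ⊗ₜ (1 ⊗ₜ 1) := rfl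

lemma tripleSnd_apply (x : H) : tripleSnd (k := k) x = 1 ⊗ₜ (x ⊗ₜ 1) := rfl

lemma tripleThd_apply (x : H) : tripleThd (k := k) x = 1 ⊗ₜ (1 ⊗ₜ x) := rfl

variable (f : H → H → H → M) [∀ y z, Lin k fun x => f x y z]
    [∀ x z, Lin k fun y => f x y z] [∀ x y, Lin k fun z => f x y z]

/-- the linear map on `H ⊗ H ⊗ H` underlying a trilinear function -/
def trilin : H ⊗[k] (H ⊗[k] H) →ₗ[k] M := bilin (fun x s => sw s (f x))

lemma trilin_tmul (x y z : H) : trilin (k := k) f (x ⊗ₜ (y ⊗ₜ z)) = f x y z := by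
  simp only [trilin, bilin_tmul, sw_tmul]

/-- Inversion of the hexagon takes place in an algebra, so the identity is proved for the three
canonical legs of H ⊗ H ⊗ H and then pushed forward along the trilinear function. -/
lemma sw_inv_comul_left :
    (sw 𝓡.inv fun r s => sw (comul (R := k) r) fun x y => f x y s) =
      sw 𝓡.inv fun r s => sw 𝓡.inv fun r' s' => f r' r (s * s') := by
  have h := congrArg (trilin (k := k) f) (sw_inv_comul_left_mul 𝓡 (i := tripleFst (k := k))
    (j := tripleSnd) (l := tripleThd)
    (fun x y => by simp [Commute, SemiconjBy, tripleFst_apply, tripleSnd_apply])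
    (fun x y => by simp [Commute, SemiconjBy, tripleFst_apply, tripleThd_apply])
    (fun x y => by simp [Commute, SemiconjBy, tripleSnd_apply, tripleThd_apply]))
  simp only [leg, sw_mul, mul_sw, map_sw, tripleFst_apply, tripleSnd_apply,
    tripleThd_apply, Algebra.TensorProduct.tmul_mul_tmul, one_mul, mul_one, trilin_tmul] at h
  rw [h, sw_comm]

lemma sw_inv_comul_right :
    (sw 𝓡.inv fun r s => sw (comul (R := k) s) fun x y => f r x y) =
      sw 𝓡.inv fun r s => sw 𝓡.inv fun r' s' => f (r * r') s s' := by
  have h := congrArg (trilin (k := k) f) (sw_inv_comul_right_mul 𝓡 (i := tripleFst (k := k))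
    (j := tripleSnd) (l := tripleThd)
    (fun x y => by simp [Commute, SemiconjBy, tripleSnd_apply, tripleThd_apply])
    (fun x y => by simp [Commute, SemiconjBy, tripleFst_apply, tripleSnd_apply])
    (fun x y => by simp [Commute, SemiconjBy, tripleFst_apply, tripleThd_apply]))
  simp only [leg, sw_mul, mul_sw, map_sw, tripleFst_apply, tripleSnd_apply,
    tripleThd_apply, Algebra.TensorProduct.tmul_mul_tmul, one_mul, mul_one, trilin_tmul] at h
  rw [h, sw_comm]

end Triple

section Pair

variable (f : H → H → M) [∀ y, Lin k fun x => f x y] [∀ x, Lin k fun y => f x y]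

lemma sw_comul_mat (x : H) :
    (sw (comul (R := k) x) fun p q => sw 𝓡.mat fun r s => f (q * r) (p * s)) =
      sw (comul (R := k) x) fun p q => sw 𝓡.mat fun r s => f (r * p) (s * q) := by
  have h := congrArg (fun t => bilin (k := k) f (sw t fun p q => p ⊗ₜ q)) (mat_mul_comul 𝓡 x)
  simp only [sw_mul_tensor, sw_comm_tensor, map_sw, bilin_tmul] at h
  rw [← h, sw_comm]

lemma sw_comul_inv (x : H) :
    (sw (comul (R := k) x) fun p q => sw 𝓡.inv fun r s => f (p * r) (q * s)) =
      sw (comul (R := k) x) fun p q => sw 𝓡.inv fun r s => f (r * q) (s * p) := by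
  have h := congrArg (fun t => bilin (k := k) f (sw t fun p q => p ⊗ₜ q)) (comul_mul_inv 𝓡 x)
  simp only [sw_mul_tensor, sw_comm_tensor, map_sw, bilin_tmul] at h
  rw [h, sw_comm]

end Pair

section Counit

lemma mul_eq_sw (a t : H ⊗[k] H) : a * t = sw t fun x y => a * x ⊗ₜ y :=
  map_eq_sw (LinearMap.mulLeft k a) t

lemma eq_mul_sw (a t : H ⊗[k] H) : t * a = sw t fun x y => x ⊗ₜ y * a :=
  map_eq_sw (LinearMap.mulRight k a) t

/-- Applying ε to the first leg of (Δ ⊗ id) R = R₁₃ R₂₃ gives R = (1 ⊗ (ε ⊗ id) R) R, and R can be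
cancelled. -/
lemma sw_mat_counit_left_self : (sw 𝓡.mat fun r s => counit (R := k) r • s) = 1 := by
  have h := sw_mat_comul_left (k := k) 𝓡 fun x y s => counit (R := k) x • (y ⊗ₜ[k] s)
  simp only [sw_counit_left, sw_tmul_self] at h
  have e : (1 ⊗ₜ[k] sw 𝓡.mat fun r s => counit (R := k) r • s) * 𝓡.mat = 𝓡.mat := by
    conv_rhs => rw [h]
    rw [mul_eq_sw]
    simp only [sw_tmul_right, sw_mul, Algebra.TensorProduct.tmul_mul_tmul,
      TensorProduct.tmul_smul, smul_mul_assoc, one_mul]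
    rw [sw_comm]
  have e' := congrArg (· * 𝓡.inv) e
  simp only [mul_assoc, mat_mul_inv, mul_one] at e'
  simpa [Algebra.TensorProduct.one_def] using
    congrArg ((TensorProduct.lid k H).toLinearMap ∘ₗ (counit (R := k)).rTensor H) e'

lemma sw_mat_counit_right_self : (sw 𝓡.mat fun r s => counit (R := k) s • r) = 1 := by
  have h := sw_mat_comul_right (k := k) 𝓡 fun r x y => counit (R := k) x • (r ⊗ₜ[k] y)
  simp only [sw_counit_left, sw_tmul_self] at h
  have e : 𝓡.mat * ((sw 𝓡.mat fun r s => counit (R := k) s • r) ⊗ₜ[k] 1) = 𝓡.mat := by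
    conv_rhs => rw [h]
    rw [eq_mul_sw]
    simp only [sw_tmul_left, mul_sw, Algebra.TensorProduct.tmul_mul_tmul,
      TensorProduct.smul_tmul', mul_smul_comm, mul_one]
  have e' := congrArg (𝓡.inv * ·) e
  simp only [← mul_assoc, inv_mul_mat, one_mul] at e'
  simpa [Algebra.TensorProduct.one_def] using
    congrArg ((TensorProduct.rid k H).toLinearMap ∘ₗ (counit (R := k)).lTensor H) e'

variable (f : H → M) [Lin k f]

lemma sw_mat_counit_left : (sw 𝓡.mat fun r s => counit (R := k) r • f s) = f 1 := by
  have h := congrArg (lin (k := k) f) (sw_mat_counit_left_self 𝓡)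
  simpa only [map_sw, map_smul, lin_apply] using h

lemma sw_mat_counit_right : (sw 𝓡.mat fun r s => counit (R := k) s • f r) = f 1 := by
  have h := congrArg (lin (k := k) f) (sw_mat_counit_right_self 𝓡)
  simpa only [map_sw, map_smul, lin_apply] using h

lemma sw_inv_counit_left : (sw 𝓡.inv fun r s => counit (R := k) r • f s) = f 1 := by
  have h := sw_mat_inv 𝓡 fun x y => counit (R := k) x • y
  have e : (sw 𝓡.mat fun r s => counit (R := k) r • s) *
      (sw 𝓡.inv fun r s => counit (R := k) r • s) = 1 := by
    simpa only [sw_mul, mul_sw, Bialgebra.counit_mul, Bialgebra.counit_one, one_smul,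
      smul_mul_smul_comm, sw_comm 𝓡.inv 𝓡.mat] using h
  rw [sw_mat_counit_left_self, one_mul] at e
  simpa [map_sw] using congrArg (lin (k := k) f) e

lemma sw_inv_counit_right : (sw 𝓡.inv fun r s => counit (R := k) s • f r) = f 1 := by
  have h := sw_mat_inv 𝓡 fun x y => counit (R := k) y • x
  have e : (sw 𝓡.mat fun r s => counit (R := k) s • r) *
      (sw 𝓡.inv fun r s => counit (R := k) s • r) = 1 := by
    simpa only [sw_mul, mul_sw, Bialgebra.counit_mul, Bialgebra.counit_one, one_smul,
      smul_mul_smul_comm, sw_comm 𝓡.inv 𝓡.mat] using h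
  rw [sw_mat_counit_right_self, one_mul] at e
  simpa [map_sw] using congrArg (lin (k := k) f) e

end Counit

section Antipode

lemma sw_comul_antipode_left (x : H) (f : H → M) [Lin k f] :
    (sw (comul (R := k) x) fun p q => f (antipode k p * q)) = counit (R := k) x • f 1 := by
  have h := congrArg (lin (k := k) f) (mul_antipode_rTensor_comul_apply (R := k) x)
  rw [map_eq_sw (LinearMap.rTensor _ _)] at h
  simpa [map_sw, Algebra.algebraMap_eq_smul_one] using h

lemma sw_mat_antipode : (sw 𝓡.mat fun r s => antipode k r ⊗ₜ[k] s) = 𝓡.inv := by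
  refine left_inv_eq_right_inv ?_ 𝓡.mat_mul_inv
  have h := sw_mat_comul_left 𝓡 fun x y s => (antipode k x * y) ⊗ₜ[k] s
  rw [sw_congr fun r s => sw_comul_antipode_left r fun x => x ⊗ₜ[k] s, sw_mat_counit_left] at h
  rw [mul_eq_sw, Algebra.TensorProduct.one_def, h]
  simp only [sw_mul, Algebra.TensorProduct.tmul_mul_tmul]
  rw [sw_comm]

lemma sw_inv_antipode : (sw 𝓡.inv fun r s => r ⊗ₜ[k] antipode k s) = 𝓡.mat := by
  refine left_inv_eq_right_inv ?_ 𝓡.inv_mul_mat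
  have h := sw_inv_comul_right 𝓡 fun s x y => s ⊗ₜ[k] (antipode k x * y)
  rw [sw_congr fun r s => sw_comul_antipode_left s fun x => r ⊗ₜ[k] x, sw_inv_counit_right] at h
  rw [mul_eq_sw, Algebra.TensorProduct.one_def, h]
  simp only [sw_mul, Algebra.TensorProduct.tmul_mul_tmul]
  rw [sw_comm]

/-- the inverse R-matrix is invariant under `S ⊗ S` -/
lemma sw_inv_antipode_antipode (f : H → H → M) [∀ y, Lin k fun x => f x y]
    [∀ x, Lin k fun y => f x y] :
    (sw 𝓡.inv fun r s => f (antipode k r) (antipode k s)) = sw 𝓡.inv f := by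
  -- Applies S ⊗ id to (id ⊗ S) R⁻¹ = R, whose right side then becomes R⁻¹.
  have h := congrArg (fun t => sw t fun r s => antipode k r ⊗ₜ[k] s) 𝓡.sw_inv_antipode
  simp only [sw_sw, sw_tmul, sw_mat_antipode] at h
  have e := congrArg (bilin (k := k) f) h
  rw [map_sw, bilin_eq_sw] at e
  simpa only [bilin_tmul] using e

end Antipode

lemma sw_comul_mul_eq (x y : H) (f : H → H → M) [∀ y, Lin k fun x => f x y]
    [∀ x, Lin k fun y => f x y] : sw (comul (R := k) (x * y)) f =
      sw (comul (R := k) x) fun p q => sw (comul (R := k) y) fun r s => f (p * r) (q * s) := by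
  rw [Bialgebra.comul_mul, sw_mul_tensor]

/-- The R-matrix content of the Leibniz rule for the coregular action. The hexagons expand (Δ ⊗ Δ)
R⁻¹ into copies of R⁻¹ in legs 12, 14, 32 and 34, and the extra R in legs 32 cancels one of them. -/
lemma sw_mat_inv_comul_comul (Φ : H ⊗[k] (H ⊗[k] (H ⊗[k] H)) →ₗ[k] M) :
    (sw 𝓡.mat fun r s => sw 𝓡.inv fun p q => sw (comul (R := k) p) fun p₁ p₂ =>
      sw (comul (R := k) q) fun q₁ q₂ => Φ (p₁ ⊗ₜ ((s * q₁) ⊗ₜ ((r * p₂) ⊗ₜ q₂)))) =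
    sw 𝓡.inv fun r s => sw 𝓡.inv fun p' q' => sw 𝓡.inv fun p q =>
      Φ ((p * r) ⊗ₜ (q ⊗ₜ (p' ⊗ₜ (q' * s)))) := by
  calc _ = sw 𝓡.mat fun r s => sw 𝓡.inv fun p q => sw 𝓡.inv fun p' q' =>
        sw (comul (R := k) (p * p')) fun p₁ p₂ =>
          Φ (p₁ ⊗ₜ ((s * q) ⊗ₜ ((r * p₂) ⊗ₜ q'))) := by
        refine sw_congr fun r s => ?_
        rw [← 𝓡.sw_inv_comul_right fun p q₁ q₂ => sw (comul (R := k) p) fun p₁ p₂ =>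
          Φ (p₁ ⊗ₜ ((s * q₁) ⊗ₜ ((r * p₂) ⊗ₜ q₂)))]
        exact sw_congr fun p q => sw_comm _ _ _
    _ = sw 𝓡.mat fun r s => sw 𝓡.inv fun p q => sw (comul (R := k) p) fun p₁ p₂ =>
        sw 𝓡.inv fun p' q' => sw (comul (R := k) p') fun p'₁ p'₂ =>
          Φ ((p₁ * p'₁) ⊗ₜ ((s * q) ⊗ₜ ((r * (p₂ * p'₂)) ⊗ₜ q'))) := by
        simp only [sw_comul_mul_eq]
        exact sw_congr fun r s => sw_congr fun p q => sw_comm _ _ _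
    _ = sw 𝓡.mat fun r s => sw 𝓡.inv fun p q => sw 𝓡.inv fun p' q' =>
        sw 𝓡.inv fun a b => sw 𝓡.inv fun a' b' =>
          Φ ((p' * a') ⊗ₜ ((s * q * q') ⊗ₜ ((r * p * a) ⊗ₜ (b * b')))) := by
        refine sw_congr fun r s => ?_
        rw [𝓡.sw_inv_comul_left fun p₁ p₂ q => sw 𝓡.inv fun p' q' =>
          sw (comul (R := k) p') fun p'₁ p'₂ =>
          Φ ((p₁ * p'₁) ⊗ₜ ((s * q) ⊗ₜ ((r * (p₂ * p'₂)) ⊗ₜ q')))]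
        refine sw_congr fun p q => sw_congr fun p' q' => ?_
        rw [𝓡.sw_inv_comul_left fun p'₁ p'₂ y =>
          Φ ((p' * p'₁) ⊗ₜ ((s * (q * q')) ⊗ₜ ((r * (p * p'₂)) ⊗ₜ y)))]
        simp only [mul_assoc]
    _ = sw 𝓡.inv fun p q => sw 𝓡.inv fun p' q' => sw 𝓡.inv fun r s =>
      Φ ((p * r) ⊗ₜ (q ⊗ₜ (p' ⊗ₜ (q' * s)))) := by
        rw [𝓡.sw_mat_inv fun x y => sw 𝓡.inv fun p' q' =>
          sw 𝓡.inv fun a b => sw 𝓡.inv fun a' b' =>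
          Φ ((p' * a') ⊗ₜ ((y * q') ⊗ₜ ((x * a) ⊗ₜ (b * b'))))]
        simp only [one_mul]
    _ = _ := by
        rw [sw_congr fun p q => sw_comm 𝓡.inv 𝓡.inv _, sw_comm]
        exact sw_congr fun r s => sw_comm _ _ _

end QuasitriangularStructure

/-! ### Braided groups and the antimultiplicativity of the braided antipode. -/

namespace BraidedGroup

variable {k H B : Type*} [Field k] [Ring H] [HopfAlgebra k H] [Ring B] [Algebra k B]
  [Coalgebra k B] {𝓡 : QuasitriangularStructure k H} (𝓑 : BraidedGroup 𝓡 B)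
  {M : Type*} [AddCommMonoid M] [Module k M]

lemma mul_act_sw (a b : B) (h : H) :
    𝓑.act (a * b) h = sw (comul (R := k) h) fun p q => 𝓑.act a p * 𝓑.act b q := by
  rw [𝓑.mul_act, TensorProduct.map₂_apply_tmul, map_eq_sw (TensorProduct.map _ _), map_sw]
  simp

section Coproduct

variable (f : B → B → M) [∀ y, Lin k fun x => f x y] [∀ x, Lin k fun y => f x y]

lemma map₂_act_act {V W : Type*} [AddCommMonoid V] [Module k V] [AddCommMonoid W] [Module k W]
    (α : V →ₗ[k] H →ₗ[k] V) (β : W →ₗ[k] H →ₗ[k] W) (t : V ⊗[k] W) (u : H ⊗[k] H) :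
    TensorProduct.map₂ α β t u =
      sw t fun x y => sw u fun p q => α x p ⊗ₜ[k] β y q := by
  rw [map_eq_sw (TensorProduct.map₂ α β t) u, sw_comm]
  refine sw_congr fun p q => ?_
  rw [← LinearMap.flip_apply, map_eq_sw ((TensorProduct.map₂ α β).flip _)]
  simp

lemma sw_comul_act (b : B) (h : H) :
    sw (comul (R := k) (𝓑.act b h)) f =
      sw (comul (R := k) b) fun x y => sw (comul (R := k) h) fun p q =>
        f (𝓑.act x p) (𝓑.act y q) := by
  rw [𝓑.comul_act, ← bilin_eq_sw, map₂_act_act]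
  simp only [map_sw, bilin_tmul]

lemma sw_comul_one {𝓡 : QuasitriangularStructure k H} (𝓑 : BraidedGroup 𝓡 B) :
    sw (comul (R := k) (1 : B)) f = f 1 1 := by
  rw [𝓑.comul_one, sw_tmul]

lemma braiding_tmul {V W : Type*} [AddCommGroup V] [Module k V] [AddCommGroup W] [Module k W]
    (α : V →ₗ[k] H →ₗ[k] V) (β : W →ₗ[k] H →ₗ[k] W) (v : V) (w : W) :
    braiding 𝓡 α β (v ⊗ₜ[k] w) = sw 𝓡.mat fun r s => β w r ⊗ₜ[k] α v s := by
  simp only [braiding, LinearMap.comp_apply, LinearEquiv.coe_coe, TensorProduct.comm_tmul,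
    LinearMap.flip_apply, TensorProduct.map₂_apply_tmul]
  rw [map_eq_sw (TensorProduct.map _ _)]
  rfl

lemma sw_comul_mul (a b : B) :
    sw (comul (R := k) (a * b)) f =
      sw (comul (R := k) a) fun x y => sw (comul (R := k) b) fun z w => sw 𝓡.mat fun r s =>
        f (x * 𝓑.act z r) (𝓑.act y s * w) := by
  rw [𝓑.comul_mul, ← bilin_eq_sw]
  conv_lhs => rw [← sw_tmul_self (comul (R := k) a), ← sw_tmul_self (comul (R := k) b)]
  simp only [sw_tmul_left, sw_tmul_right, map_sw, sw_comm (comul (R := k) b) (comul (R := k) a)]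
  refine sw_congr fun x y => sw_congr fun z w => ?_
  simp only [braidedTensorMul, LinearMap.comp_apply, LinearEquiv.coe_coe,
    TensorProduct.assoc_tmul, TensorProduct.assoc_symm_tmul, LinearMap.lTensor_tmul,
    LinearMap.rTensor_tmul, braiding_tmul, sw_tmul_left, sw_tmul_right, map_sw,
    TensorProduct.map_tmul, LinearMap.mul'_apply, bilin_tmul]

end Coproduct

section Antipode

variable (f : B → M) [Lin k f]

lemma sw_antipode_left (b : B) :
    (sw (comul (R := k) b) fun x y => f (𝓑.antipode x * y)) = counit (R := k) b • f 1 := by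
  have h := congrArg (lin (k := k) f) (𝓑.antipode_mul b)
  rw [map_eq_sw (LinearMap.rTensor _ _)] at h
  simpa [map_sw, Algebra.algebraMap_eq_smul_one] using h

lemma sw_antipode_right (b : B) :
    (sw (comul (R := k) b) fun x y => f (x * 𝓑.antipode y)) = counit (R := k) b • f 1 := by
  have h := congrArg (lin (k := k) f) (𝓑.mul_antipode b)
  rw [map_eq_sw (LinearMap.lTensor _ _)] at h
  simpa [map_sw, Algebra.algebraMap_eq_smul_one] using h

lemma antipode_one : 𝓑.antipode 1 = 1 := by
  have h := 𝓑.antipode_mul 1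
  rw [𝓑.comul_one, 𝓑.counit_one] at h
  simpa using h

lemma counit_antipode (b : B) : counit (R := k) (𝓑.antipode b) = counit (R := k) b := by
  have h := 𝓑.sw_antipode_left (fun x => counit (R := k) x) b
  simp only [𝓑.counit_mul, 𝓑.counit_one, smul_eq_mul, mul_one] at h
  rw [← h]
  simpa [mul_comm] using (sw_counit_right (k := k) b
    (fun x => counit (R := k) (𝓑.antipode x))).symm

/-- The antipode axiom for the product ab, with Δ(ab) expanded, is `key`; multiplying on the right
by the antipode of a further part of b removes the factor b₂. This is half of the argument that both
sides of `antipode_mul_eq` are the same convolution inverse of the product. -/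
lemma sw_antipode_mul_act (a b : B) :
    (sw (comul (R := k) a) fun x y => sw 𝓡.mat fun r s =>
      𝓑.antipode (x * 𝓑.act b r) * 𝓑.act y s) = counit (R := k) a • 𝓑.antipode b := by
  have key (b : B) : (sw (comul (R := k) a) fun x y => sw (comul (R := k) b) fun z w =>
      sw 𝓡.mat fun r s => 𝓑.antipode (x * 𝓑.act z r) * (𝓑.act y s * w)) =
      counit (R := k) b • counit (R := k) a • (1 : B) := by
    rw [← 𝓑.sw_comul_mul (fun x y => 𝓑.antipode x * y), 𝓑.sw_antipode_left (fun x => x),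
      𝓑.counit_mul, smul_smul, mul_comm]
  rw [← sw_counit_right (k := k) b fun b => sw (comul (R := k) a) fun x y => sw 𝓡.mat fun r s =>
      𝓑.antipode (x * 𝓑.act b r) * 𝓑.act y s]
  calc _ = sw (comul (R := k) b) fun b₁ b₂ => sw (comul (R := k) b₂) fun z w =>
        (sw (comul (R := k) a) fun x y => sw 𝓡.mat fun r s =>
          𝓑.antipode (x * 𝓑.act b₁ r) * 𝓑.act y s) * (z * 𝓑.antipode w) := by
        refine sw_congr fun b₁ b₂ => ?_
        rw [𝓑.sw_antipode_right (fun x => _ * x), mul_one]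
    _ = sw (comul (R := k) b) fun b₁ b₂ => (sw (comul (R := k) a) fun x y =>
          sw (comul (R := k) b₁) fun z w => sw 𝓡.mat fun r s =>
          𝓑.antipode (x * 𝓑.act z r) * (𝓑.act y s * w)) * 𝓑.antipode b₂ := by
        rw [← sw_coassoc]
        refine sw_congr fun b₁ b₂ => ?_
        simp only [sw_mul, mul_assoc]
        rw [sw_comm]
    _ = _ := by
        simp only [key, smul_mul_assoc, one_mul]
        rw [sw_counit_left b fun y => counit (R := k) a • 𝓑.antipode y]

/-- the braided antipode is braided-antimultiplicative -/
lemma antipode_mul_eq (a b : B) :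
    𝓑.antipode (a * b) =
      sw 𝓡.mat fun r s => 𝓑.act (𝓑.antipode b) r * 𝓑.act (𝓑.antipode a) s := by
  symm
  calc _ = sw 𝓡.mat fun p q => sw (comul (R := k) a) fun a₁ a₂ =>
        (sw (comul (R := k) a₁) fun x y => sw 𝓡.mat fun r s =>
          𝓑.antipode (x * 𝓑.act (𝓑.act b p) r) * 𝓑.act y s) * 𝓑.act (𝓑.antipode a₂) q := by
        refine sw_congr fun p q => ?_
        simp only [sw_antipode_mul_act, smul_mul_assoc, 𝓑.antipode_act]
        rw [sw_counit_left a fun y => 𝓑.act (𝓑.antipode b) p * 𝓑.act (𝓑.antipode y) q]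
    _ = sw 𝓡.mat fun p q => sw (comul (R := k) a) fun x a₂ => sw (comul (R := k) a₂) fun y z =>
          sw 𝓡.mat fun r s => 𝓑.antipode (x * 𝓑.act b (p * r)) *
            (𝓑.act y s * 𝓑.act (𝓑.antipode z) q) := by
        refine sw_congr fun p q => ?_
        simp only [sw_mul]
        rw [sw_coassoc]
        simp only [mul_assoc, 𝓑.act_mul]
    -- The second hexagon read backwards lets a single R act on the product y · S z, which the
    -- antipode axiom then removes.
    _ = sw (comul (R := k) a) fun x a₂ => sw (comul (R := k) a₂) fun y z =>
          sw 𝓡.mat fun p q => 𝓑.antipode (x * 𝓑.act b p) * 𝓑.act (y * 𝓑.antipode z) q := by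
        simp only [mul_act_sw, mul_sw]
        rw [sw_comm]
        refine sw_congr fun x a₂ => ?_
        rw [sw_comm]
        refine sw_congr fun y z => ?_
        rw [𝓡.sw_mat_comul_right fun p u v => 𝓑.antipode (x * 𝓑.act b p) *
            (𝓑.act y u * 𝓑.act (𝓑.antipode z) v)]
    _ = sw (comul (R := k) a) fun x a₂ => counit (R := k) a₂ • 𝓑.antipode (x * b) := by
        refine sw_congr fun x a₂ => ?_
        rw [𝓑.sw_antipode_right fun w =>
          sw 𝓡.mat fun p q => 𝓑.antipode (x * 𝓑.act b p) * 𝓑.act w q]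
        simp only [𝓑.one_act, mul_smul_comm, mul_one]
        rw [𝓡.sw_mat_counit_right fun p => 𝓑.antipode (x * 𝓑.act b p), 𝓑.act_one]
    _ = _ := sw_counit_right a fun x => 𝓑.antipode (x * b)

end Antipode

end BraidedGroup

/-! ### Anticomultiplicativity of the braided antipode. -/

namespace BraidedGroup

variable {k H B : Type*} [Field k] [Ring H] [HopfAlgebra k H] [Ring B] [Algebra k B]
  [Coalgebra k B] {𝓡 : QuasitriangularStructure k H} (𝓑 : BraidedGroup 𝓡 B)
  {M : Type*} [AddCommMonoid M] [Module k M]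

/-- Dual to `sw_antipode_mul_act`: Δ(S b₁ · b₂) = ε(b) 1 ⊗ 1 is expanded, and the right factor in
the second tensor slot is cancelled by a further antipode. The ordinary tensor algebra serves only
to multiply in that slot. -/
lemma sw_comul_antipode_mul_act (b : B) :
    (sw (comul (R := k) b) fun b₁ b₂ => sw (comul (R := k) (𝓑.antipode b₁)) fun x y =>
      sw 𝓡.mat fun r s => (x * 𝓑.act b₂ r) ⊗ₜ[k] 𝓑.act y s) = 1 ⊗ₜ[k] 𝓑.antipode b := by
  have key (b : B) : (sw (comul (R := k) b) fun b₁ b₂ =>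
      sw (comul (R := k) (𝓑.antipode b₁)) fun x y => sw (comul (R := k) b₂) fun z w =>
        sw 𝓡.mat fun r s => (x * 𝓑.act z r) ⊗ₜ[k] (𝓑.act y s * w)) =
      counit (R := k) b • (1 : B) ⊗ₜ[k] (1 : B) := by
    have h := 𝓑.sw_antipode_left (fun x => sw (comul (R := k) x) fun x y => x ⊗ₜ[k] y) b
    rw [𝓑.sw_comul_one fun x y => x ⊗ₜ[k] y] at h
    simpa only [𝓑.sw_comul_mul] using h
  rw [← sw_counit_right (k := k) b fun b => sw (comul (R := k) b) fun b₁ b₂ =>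
    sw (comul (R := k) (𝓑.antipode b₁)) fun x y =>
      sw 𝓡.mat fun r s => (x * 𝓑.act b₂ r) ⊗ₜ[k] 𝓑.act y s]
  calc _ = sw (comul (R := k) b) fun b₁ b₂ => sw (comul (R := k) b₂) fun z w =>
        (sw (comul (R := k) b₁) fun b₁ b₂ => sw (comul (R := k) (𝓑.antipode b₁)) fun x y =>
          sw 𝓡.mat fun r s => (x * 𝓑.act b₂ r) ⊗ₜ[k] 𝓑.act y s) *
            (1 ⊗ₜ[k] (z * 𝓑.antipode w)) := by
        refine sw_congr fun b₁ b₂ => ?_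
        rw [𝓑.sw_antipode_right (fun x => _ * (1 ⊗ₜ[k] x)), ← Algebra.TensorProduct.one_def,
          mul_one]
    _ = sw (comul (R := k) b) fun b₁ b₂ => (sw (comul (R := k) b₁) fun z w =>
          (sw (comul (R := k) z) fun b₁ b₂ => sw (comul (R := k) (𝓑.antipode b₁)) fun x y =>
            sw 𝓡.mat fun r s => (x * 𝓑.act b₂ r) ⊗ₜ[k] 𝓑.act y s) * (1 ⊗ₜ[k] w)) *
              (1 ⊗ₜ[k] 𝓑.antipode b₂) := by
        rw [← sw_coassoc]
        refine sw_congr fun b₁ b₂ => ?_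
        rw [sw_mul]
        simp only [mul_assoc, Algebra.TensorProduct.tmul_mul_tmul, one_mul]
    _ = sw (comul (R := k) b) fun b₁ b₂ => (counit (R := k) b₁ • (1 : B) ⊗ₜ[k] (1 : B)) *
              (1 ⊗ₜ[k] 𝓑.antipode b₂) := by
        refine sw_congr fun b₁ b₂ => ?_
        rw [← key]
        congr 1
        simp only [sw_mul, Algebra.TensorProduct.tmul_mul_tmul, mul_one]
        rw [sw_coassoc]
        exact sw_congr fun u v => sw_comm _ _ _
    _ = _ := by
        simp only [smul_mul_assoc, Algebra.TensorProduct.tmul_mul_tmul, one_mul]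
        rw [sw_counit_left b fun y => (1 : B) ⊗ₜ[k] 𝓑.antipode y]

/-- the braided antipode is braided-anticomultiplicative -/
lemma comul_antipode_eq (b : B) :
    comul (R := k) (𝓑.antipode b) = sw (comul (R := k) b) fun x y => sw 𝓡.mat fun r s =>
      𝓑.act (𝓑.antipode y) r ⊗ₜ[k] 𝓑.act (𝓑.antipode x) s := by
  symm
  calc _ = sw 𝓡.mat fun p q => sw (comul (R := k) b) fun b₁ b₂ =>
        sw (sw (comul (R := k) b₁) fun b₁ b₂ => sw (comul (R := k) (𝓑.antipode b₁)) fun x y =>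
          sw 𝓡.mat fun r s => (x * 𝓑.act b₂ r) ⊗ₜ[k] 𝓑.act y s) fun x y =>
            (x * 𝓑.act (𝓑.antipode b₂) p) ⊗ₜ[k] 𝓑.act y q := by
        simp only [sw_comul_antipode_mul_act, sw_tmul, one_mul]
        rw [sw_comm]
    _ = sw 𝓡.mat fun p q => sw (comul (R := k) b) fun z b₂ => sw (comul (R := k) b₂) fun w v =>
        sw (comul (R := k) (𝓑.antipode z)) fun x y => sw 𝓡.mat fun r s =>
          (x * (𝓑.act w r * 𝓑.act (𝓑.antipode v) p)) ⊗ₜ[k] 𝓑.act y (s * q) := by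
        refine sw_congr fun p q => ?_
        rw [← sw_coassoc]
        simp only [sw_sw, sw_tmul, mul_assoc, 𝓑.act_mul]
    -- The first hexagon read backwards, again so that R acts on w · S v as a whole.
    _ = sw (comul (R := k) b) fun z b₂ => sw (comul (R := k) b₂) fun w v =>
        sw (comul (R := k) (𝓑.antipode z)) fun x y => sw 𝓡.mat fun r s =>
          (x * 𝓑.act (w * 𝓑.antipode v) r) ⊗ₜ[k] 𝓑.act y s := by
        rw [sw_comm]
        refine sw_congr fun z b₂ => ?_
        rw [sw_comm]
        refine sw_congr fun w v => ?_
        rw [sw_comm]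
        refine sw_congr fun x y => ?_
        simp only [mul_act_sw, mul_sw, sw_tmul_left]
        rw [𝓡.sw_mat_comul_left fun r p s =>
          (x * (𝓑.act w r * 𝓑.act (𝓑.antipode v) p)) ⊗ₜ[k] 𝓑.act y s, sw_comm]
    _ = sw (comul (R := k) b) fun z b₂ => counit (R := k) b₂ •
        sw (comul (R := k) (𝓑.antipode z)) fun x y => x ⊗ₜ[k] y := by
        refine sw_congr fun z b₂ => ?_
        rw [𝓑.sw_antipode_right fun w => sw (comul (R := k) (𝓑.antipode z)) fun x y =>
          sw 𝓡.mat fun r s => (x * 𝓑.act w r) ⊗ₜ[k] 𝓑.act y s]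
        congr 1
        refine sw_congr fun x y => ?_
        simp only [𝓑.one_act, mul_smul_comm, mul_one, ← TensorProduct.smul_tmul']
        rw [𝓡.sw_mat_counit_left fun s => x ⊗ₜ[k] 𝓑.act y s, 𝓑.act_one]
    _ = _ := by
        simp only [sw_tmul_self]
        exact sw_counit_right (k := k) b fun x => comul (R := k) (𝓑.antipode x)

lemma sw_comul_antipode (b : B) (f : B → B → M) [∀ y, Lin k fun x => f x y]
    [∀ x, Lin k fun y => f x y] :
    sw (comul (R := k) (𝓑.antipode b)) f = sw (comul (R := k) b) fun x y =>
      sw 𝓡.mat fun r s => f (𝓑.act (𝓑.antipode y) r) (𝓑.act (𝓑.antipode x) s) := by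
  rw [comul_antipode_eq]
  simp only [sw_sw, sw_tmul]

end BraidedGroup

/-! ### The duality pairing and the structure of C̄. -/

namespace Datum

variable {k H B C : Type*} [Field k] [Ring H] [HopfAlgebra k H] [Ring B] [Algebra k B]
  [Coalgebra k B] [Ring C] [Algebra k C] [Coalgebra k C] (X : Datum k H B C)
  {M : Type*} [AddCommMonoid M] [Module k M]

lemma R_eq : X.R = X.𝓡.mat := rfl

lemma Rinv_eq : X.Rinv = X.𝓡.inv := rfl

section Pairing

lemma sw_ev_act (c : C) (b : B) (h : H) :
    (sw (comul (R := k) h) fun p q => X.ev (X.𝓒.act c p) (X.𝓑.act b q)) =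
      counit (R := k) h • X.ev c b := by
  rw [smul_eq_mul, ← X.ev_act, TensorProduct.map₂_apply_tmul, map_eq_sw (TensorProduct.map _ _),
    map_sw]
  rfl

lemma barAct_apply (h : H) (c : C) : X.barAct h c = X.𝓒.act c (antipode k h) := rfl

/-- the pairing moves the left action on `C̄` to the right action on `B` -/
lemma ev_barAct (h : H) (c : C) (b : B) : X.ev (X.barAct h c) b = X.ev c (X.𝓑.act b h) := by
  -- Invariance trades ε(h₂) for an action of h₂ on both arguments; on C it meets S h₁ and cancels.
  rw [barAct_apply, ← sw_counit_right (k := k) h fun x => X.ev (X.𝓒.act c (antipode k x)) b]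
  calc _ = sw (comul (R := k) h) fun x y => sw (comul (R := k) y) fun p q =>
        X.ev (X.𝓒.act c (antipode k x * p)) (X.𝓑.act b q) := by
        simp only [X.𝓒.act_mul, sw_ev_act]
    _ = sw (comul (R := k) h) fun x y => counit (R := k) x • X.ev c (X.𝓑.act b y) := by
        rw [← sw_coassoc]
        refine sw_congr fun x y => ?_
        rw [QuasitriangularStructure.sw_comul_antipode_left x fun z =>
          X.ev (X.𝓒.act c z) (X.𝓑.act b y), X.𝓒.act_one]
    _ = _ := sw_counit_left h fun y => X.ev c (X.𝓑.act b y)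

lemma ev_mul_left_sw (c d : C) (b : B) :
    X.ev (c * d) b = sw (comul (R := k) b) fun x y => X.ev d x * X.ev c y := by
  rw [X.ev_mul_left, map_eq_sw (TensorProduct.map _ _), map_sw]
  rfl

lemma ev_mul_right_sw (c : C) (a b : B) :
    X.ev c (a * b) = sw (comul (R := k) c) fun x y => X.ev x b * X.ev y a := by
  rw [X.ev_mul_right, map_eq_sw (TensorProduct.map _ _), map_sw]
  rfl

/-- the braided antipodes are adjoint for the pairing -/
lemma ev_antipode (c : C) (b : B) : X.ev (X.𝓒.antipode c) b = X.ev c (X.𝓑.antipode b) := by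
  -- Both sides equal ⟨S c₁, b₃⟩ ⟨c₂, b₂⟩ ⟨c₃, S b₁⟩: contracting b₁ with b₂ gives one, contracting
  -- c₁ with c₂ gives the other.
  calc _ = sw (comul (R := k) b) fun x y => counit (R := k) x • sw (comul (R := k) c) fun z w =>
        counit (R := k) w • X.ev (X.𝓒.antipode z) y := by
        simp only [sw_counit_right c fun z => X.ev (X.𝓒.antipode z) _]
        rw [sw_counit_left b fun y => X.ev (X.𝓒.antipode c) y]
    _ = sw (comul (R := k) c) fun z w => sw (comul (R := k) b) fun x y =>
        sw (comul (R := k) x) fun p q =>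
          X.ev w (X.𝓑.antipode p * q) * X.ev (X.𝓒.antipode z) y := by
        rw [sw_comm]
        refine sw_congr fun x y => ?_
        rw [smul_sw]
        refine sw_congr fun z w => ?_
        rw [X.𝓑.sw_antipode_left fun u => X.ev w u * X.ev (X.𝓒.antipode z) y, X.ev_one_right,
          smul_eq_mul, smul_eq_mul, smul_eq_mul]
    _ = sw (comul (R := k) b) fun p y => sw (comul (R := k) c) fun z w =>
        sw (comul (R := k) z) fun u v =>
          X.ev (X.𝓒.antipode u * v) y * X.ev w (X.𝓑.antipode p) := by
        simp only [sw_coassoc]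
        rw [sw_comm]
        simp only [ev_mul_left_sw, ev_mul_right_sw, sw_mul]
        refine sw_congr fun p y => sw_congr fun z w => ?_
        rw [sw_comm]
        exact sw_congr fun u v => sw_congr fun q y' => by ring
    _ = sw (comul (R := k) b) fun p y => counit (R := k) y • sw (comul (R := k) c) fun z w =>
        counit (R := k) z • X.ev w (X.𝓑.antipode p) := by
        refine sw_congr fun p y => ?_
        rw [smul_sw]
        refine sw_congr fun z w => ?_
        rw [X.𝓒.sw_antipode_left fun u => X.ev u y * X.ev w (X.𝓑.antipode p), X.ev_one_left,
          smul_eq_mul, smul_eq_mul, smul_eq_mul]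
        ring
    _ = _ := by
        simp only [sw_counit_left c fun z => X.ev z _]
        rw [sw_counit_right b fun p => X.ev c (X.𝓑.antipode p)]

end Pairing

section BarStructure

lemma antipode_barAntipode (c : C) : X.𝓒.antipode (X.barAntipode c) = c :=
  (LinearEquiv.ofBijective X.𝓒.antipode X.antipode_bijective).apply_symm_apply c

lemma barAntipode_antipode (c : C) : X.barAntipode (X.𝓒.antipode c) = c :=
  (LinearEquiv.ofBijective X.𝓒.antipode X.antipode_bijective).symm_apply_apply c

lemma barAntipode_one : X.barAntipode 1 = 1 := by
  rw [← X.𝓒.antipode_one, barAntipode_antipode, X.𝓒.antipode_one]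

lemma counit_barAntipode (c : C) : counit (R := k) (X.barAntipode c) = counit (R := k) c := by
  rw [← X.𝓒.counit_antipode, antipode_barAntipode]

lemma barAntipode_act (c : C) (h : H) :
    X.barAntipode (X.𝓒.act c h) = X.𝓒.act (X.barAntipode c) h := by
  conv_lhs => rw [← X.antipode_barAntipode c]
  rw [← X.𝓒.antipode_act, barAntipode_antipode]

lemma ev_barAntipode_barAct (h : H) (c : C) (b : B) :
    X.ev (X.barAntipode (X.barAct h c)) b = X.ev (X.barAntipode c) (X.𝓑.act b h) := by
  rw [barAct_apply, barAntipode_act, ← barAct_apply, ev_barAct]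

lemma ev_barAntipode_antipode (c : C) (b : B) :
    X.ev (X.barAntipode c) (X.𝓑.antipode b) = X.ev c b := by
  rw [← ev_antipode, antipode_barAntipode]

lemma barComul_eq (c : C) : X.barComul c = sw (comul (R := k) c) fun x y =>
    sw X.𝓡.inv fun r s => X.barAct r x ⊗ₜ[k] X.barAct s y := by
  have h : X.barComul c =
      TensorProduct.map₂ X.barAct X.barAct X.𝓡.inv (comul (R := k) c) := by
    simp [barComul, barBraidingInv, Rinv_eq]
  rw [h, map_eq_sw (TensorProduct.map₂ _ _ _)]
  refine sw_congr fun x y => ?_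
  rw [← LinearMap.flip_apply, map_eq_sw ((TensorProduct.map₂ _ _).flip _)]
  rfl

/-- the coproduct of `C̄` in terms of the coproduct of `S̄ c` in `C` -/
lemma sw_barComul (c : C) (f : C → C → M) [∀ y, Lin k fun x => f x y]
    [∀ x, Lin k fun y => f x y] :
    sw (X.barComul c) f = sw (comul (R := k) (X.barAntipode c)) fun x y =>
      f (X.𝓒.antipode y) (X.𝓒.antipode x) := by
  have h : X.barComul c = sw (comul (R := k) (X.barAntipode c)) fun x y =>
      X.𝓒.antipode y ⊗ₜ[k] X.𝓒.antipode x := by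
    rw [barComul_eq]
    conv_lhs => rw [← X.antipode_barAntipode c]
    simp only [barAct_apply]
    calc _ = sw (comul (R := k) (X.𝓒.antipode (X.barAntipode c))) fun x y =>
          sw X.𝓡.inv fun r s => X.𝓒.act x r ⊗ₜ[k] X.𝓒.act y s :=
          sw_congr fun x y => X.𝓡.sw_inv_antipode_antipode fun r s =>
            X.𝓒.act x r ⊗ₜ[k] X.𝓒.act y s
      _ = _ := by
        rw [X.𝓒.sw_comul_antipode]
        refine sw_congr fun x y => ?_
        simp only [← X.𝓒.act_mul]
        rw [X.𝓡.sw_mat_inv fun r s =>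
          X.𝓒.act (X.𝓒.antipode y) r ⊗ₜ[k] X.𝓒.act (X.𝓒.antipode x) s, X.𝓒.act_one, X.𝓒.act_one]
  rw [h, sw_sw]
  simp only [sw_tmul]

/-- The functionals ⟨S̄ c, ·⟩ see the coproduct of C̄ with no flip and no R-matrix, because its R⁻¹
cancels the R from the braided anticomultiplicativity of S. This makes S̄ natural in the coregular
action. -/
lemma ev_barAntipode_mul (c : C) (a b : B) :
    X.ev (X.barAntipode c) (a * b) = sw (X.barComul c) fun x y =>
      X.ev (X.barAntipode x) a * X.ev (X.barAntipode y) b := by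
  rw [sw_barComul, ev_mul_right_sw]
  simp only [barAntipode_antipode, mul_comm]

/-- Inverse form of `antipode_mul_eq`: after applying the injective antipode, its R cancels the R⁻¹.
-/
lemma barAntipode_mul (c d : C) :
    X.barAntipode (d * c) = sw X.𝓡.inv fun r s =>
      X.𝓒.act (X.barAntipode c) s * X.𝓒.act (X.barAntipode d) r := by
  apply X.antipode_bijective.injective
  rw [antipode_barAntipode, map_sw]
  simp only [X.𝓒.antipode_mul_eq, X.𝓒.antipode_act, antipode_barAntipode, ← X.𝓒.act_mul]
  rw [X.𝓡.sw_inv_mat fun r s => X.𝓒.act d r * X.𝓒.act c s, X.𝓒.act_one, X.𝓒.act_one]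

lemma ev_barAntipode_barMul (c d : C) (b : B) :
    X.ev (X.barAntipode (X.barMul c d)) b = sw (comul (R := k) b) fun x y =>
      sw X.𝓡.inv fun r s => X.ev (X.barAntipode d) (X.𝓑.act x r) *
        X.ev (X.barAntipode c) (X.𝓑.act y s) := by
  change X.ev (X.barAntipode (d * c)) b = _
  -- Invariance of R⁻¹ under S ⊗ S inserts the antipodes that turn the right action on C into the
  -- left action on C̄, which the pairing moves to B.
  rw [barAntipode_mul, map_sw_apply,
    ← X.𝓡.sw_inv_antipode_antipode fun r s =>
      X.ev (X.𝓒.act (X.barAntipode c) s * X.𝓒.act (X.barAntipode d) r) b]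
  simp only [← barAct_apply, ev_mul_left_sw, ev_barAct]
  rw [sw_comm]

end BarStructure

end Datum

namespace Datum

variable {k H B C : Type*} [Field k] [Ring H] [HopfAlgebra k H] [Ring B] [Algebra k B]
  [Coalgebra k B] [Ring C] [Algebra k C] [Coalgebra k C] (X : Datum k H B C)
  {M : Type*} [AddCommMonoid M] [Module k M]

/-! ### The braided adjoint action -/

lemma adjointAct_eq (v b : B) :
    X.adjointAct v b = sw (comul (R := k) b) fun x y => sw X.𝓡.mat fun r s =>
      X.𝓑.act (X.𝓑.antipode x) r * X.𝓑.act v s * y := by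
  simp only [adjointAct, TensorProduct.curry_apply, LinearMap.comp_apply, LinearEquiv.coe_coe,
    LinearMap.lTensor_tmul]
  conv_lhs => rw [← sw_tmul_self (comul (R := k) b)]
  simp only [sw_tmul_right, map_sw, TensorProduct.assoc_symm_tmul, LinearMap.rTensor_tmul,
    LinearMap.comp_apply, LinearMap.lTensor_tmul, BraidedGroup.braiding_tmul, sw_tmul_left,
    LinearMap.mul'_apply]

/-- the braided adjoint action is `H`-equivariant -/
lemma act_adjointAct (v b : B) (h : H) :
    X.𝓑.act (X.adjointAct v b) h = sw (comul (R := k) h) fun p q =>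
      X.adjointAct (X.𝓑.act v p) (X.𝓑.act b q) := by
  simp only [adjointAct_eq, map_sw_apply, X.𝓑.mul_act_sw, sw_mul, X.𝓑.sw_comul_act,
    X.𝓑.antipode_act, ← X.𝓑.act_mul]
  -- With its second tensor fixed, `sw_comm` moves that sum outward past all others. Such lines
  -- bring the two sides to a common order of summation.
  simp only [sw_comm _ (comul (R := k) h)]
  simp only [sw_comm _ (comul (R := k) b)]
  refine sw_congr fun x y => ?_
  calc _ = sw (comul (R := k) h) fun p q => sw (comul (R := k) p) fun p₁ p₂ =>
        sw X.𝓡.mat fun r s => X.𝓑.act (X.𝓑.antipode x) (p₂ * r) * X.𝓑.act v (p₁ * s) *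
          X.𝓑.act y q := by
        refine sw_congr fun p q => ?_
        rw [sw_comm, X.𝓡.sw_comul_mat fun r s =>
          X.𝓑.act (X.𝓑.antipode x) r * X.𝓑.act v s * X.𝓑.act y q]
    _ = _ := by
        rw [sw_coassoc]

/-- Both sides expand to words S z · S x · v · y · w with elements of H acting on the letters. The
actions agree by the quasi-cocommutativity of H and the two hexagons. -/
lemma adjointAct_mul (v a b : B) :
    X.adjointAct v (a * b) = X.adjointAct (X.adjointAct v a) b := by
  simp only [adjointAct_eq, X.𝓑.sw_comul_mul, X.𝓑.antipode_mul_eq, X.𝓑.antipode_act, sw_mul,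
    map_sw_apply, mul_sw, X.𝓑.mul_act_sw, ← X.𝓑.act_mul]
  simp only [sw_comm _ (comul (R := k) b)]
  simp only [sw_comm _ (comul (R := k) a)]
  refine sw_congr fun x y => sw_congr fun z w => ?_
  calc _ = sw X.𝓡.mat fun p q => sw X.𝓡.mat fun r s => sw (comul (R := k) r) fun r₁ r₂ =>
        sw X.𝓡.mat fun t u => X.𝓑.act (X.𝓑.antipode z) (p * (r₂ * t)) *
          X.𝓑.act (X.𝓑.antipode x) (r₁ * u) * X.𝓑.act v s * (X.𝓑.act y q * w) := by
        refine sw_congr fun p q => sw_congr fun r s => ?_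
        rw [X.𝓡.sw_comul_mat fun t u => X.𝓑.act (X.𝓑.antipode z) (p * t) *
          X.𝓑.act (X.𝓑.antipode x) u * X.𝓑.act v s * (X.𝓑.act y q * w), sw_comm]
        simp only [mul_assoc]
    _ = sw X.𝓡.mat fun p q => sw X.𝓡.mat fun m n => sw X.𝓡.mat fun r s =>
        sw X.𝓡.mat fun t u => X.𝓑.act (X.𝓑.antipode z) (p * (r * t)) *
          X.𝓑.act (X.𝓑.antipode x) (m * u) * X.𝓑.act v (n * s) * (X.𝓑.act y q * w) := by
        refine sw_congr fun p q => ?_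
        rw [X.𝓡.sw_mat_comul_left fun r₁ r₂ s => sw X.𝓡.mat fun t u =>
          X.𝓑.act (X.𝓑.antipode z) (p * (r₂ * t)) *
          X.𝓑.act (X.𝓑.antipode x) (r₁ * u) * X.𝓑.act v s * (X.𝓑.act y q * w)]
    _ = sw X.𝓡.mat fun p q => sw X.𝓡.mat fun m n => sw X.𝓡.mat fun r s =>
        sw (comul (R := k) s) fun u s => X.𝓑.act (X.𝓑.antipode z) (p * r) *
          X.𝓑.act (X.𝓑.antipode x) (m * u) * X.𝓑.act v (n * s) * (X.𝓑.act y q * w) := by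
        refine sw_congr fun p q => sw_congr fun m n => ?_
        rw [X.𝓡.sw_mat_comul_right fun r u s => X.𝓑.act (X.𝓑.antipode z) (p * r) *
          X.𝓑.act (X.𝓑.antipode x) (m * u) * X.𝓑.act v (n * s) * (X.𝓑.act y q * w)]
    _ = _ := by
        rw [sw_comm]
        refine sw_congr fun m n => ?_
        rw [X.𝓡.sw_mat_comul_right fun r s t => sw (comul (R := k) s) fun u s =>
          X.𝓑.act (X.𝓑.antipode z) r *
          (X.𝓑.act (X.𝓑.antipode x) (m * u) * X.𝓑.act v (n * s) * X.𝓑.act y t) * w]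
        simp only [mul_assoc]

lemma adjointAct_one (v : B) : X.adjointAct v 1 = v := by
  rw [adjointAct_eq, X.𝓑.sw_comul_one fun x y => sw X.𝓡.mat fun r s =>
      X.𝓑.act (X.𝓑.antipode x) r * X.𝓑.act v s * y]
  simp only [X.𝓑.antipode_one, X.𝓑.one_act, mul_one, smul_mul_assoc, one_mul]
  rw [X.𝓡.sw_mat_counit_left fun s => X.𝓑.act v s, X.𝓑.act_one]

lemma one_adjointAct (b : B) : X.adjointAct 1 b = counit (R := k) b • (1 : B) := by
  rw [adjointAct_eq, ← X.𝓑.sw_antipode_left fun x => x]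
  refine sw_congr fun x y => ?_
  simp only [X.𝓑.one_act, smul_mul_assoc, mul_smul_comm, mul_one]
  rw [X.𝓡.sw_mat_counit_right fun r => X.𝓑.act (X.𝓑.antipode x) r * y, X.𝓑.act_one]

/-- `B` is a module algebra for the braided adjoint action -/
lemma mul_adjointAct (v w b : B) :
    X.adjointAct (v * w) b = sw (comul (R := k) b) fun x y => sw X.𝓡.mat fun r s =>
      X.adjointAct v (X.𝓑.act x r) * X.adjointAct (X.𝓑.act w s) y := by
  simp only [adjointAct_eq, X.𝓑.sw_comul_act, X.𝓑.antipode_act, sw_mul,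
    mul_sw, X.𝓑.mul_act_sw, ← X.𝓑.act_mul]
  symm
  calc _ = sw (comul (R := k) b) fun x y => sw (comul (R := k) x) fun x₁ x₂ =>
        sw (comul (R := k) y) fun y₁ y₂ => sw X.𝓡.mat fun r s =>
        sw (comul (R := k) r) fun r₁ r₂ => sw X.𝓡.mat fun p' q' => sw X.𝓡.mat fun p q =>
        X.𝓑.act (X.𝓑.antipode x₁) (r₁ * p) * X.𝓑.act v q * X.𝓑.act x₂ r₂ *
          (X.𝓑.act (X.𝓑.antipode y₁) p' * X.𝓑.act w (s * q') * y₂) := by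
        refine sw_congr fun x y => ?_
        simp only [sw_comm _ (comul (R := k) y)]
        simp only [sw_comm _ (comul (R := k) x)]
        exact sw_congr fun x₁ x₂ => sw_congr fun y₁ y₂ => sw_congr fun r s => sw_comm _ _ _
    _ = sw (comul (R := k) b) fun x₁ y => sw (comul (R := k) y) fun x₂ y =>
        sw (comul (R := k) y) fun y₁ y₂ => sw X.𝓡.mat fun r s => sw X.𝓡.mat fun r' s' =>
        sw X.𝓡.mat fun p' q' => sw X.𝓡.mat fun p q =>
        X.𝓑.act (X.𝓑.antipode x₁) (r * p) * X.𝓑.act v q * X.𝓑.act x₂ r' *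
          (X.𝓑.act (X.𝓑.antipode y₁) p' * X.𝓑.act w (s * (s' * q')) * y₂) := by
        rw [sw_coassoc]
        refine sw_congr fun x₁ y => sw_congr fun x₂ y => sw_congr fun y₁ y₂ => ?_
        rw [X.𝓡.sw_mat_comul_left fun r₁ r₂ s => sw X.𝓡.mat fun p' q' => sw X.𝓡.mat fun p q =>
          X.𝓑.act (X.𝓑.antipode x₁) (r₁ * p) * X.𝓑.act v q * X.𝓑.act x₂ r₂ *
          (X.𝓑.act (X.𝓑.antipode y₁) p' * X.𝓑.act w (s * q') * y₂)]
        simp only [mul_assoc]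
    -- Coassociativity groups x₂ with S y₁, and the first hexagon read backwards puts a single R on
    -- their product, so that the antipode axiom can remove it.
    _ = sw (comul (R := k) b) fun x₁ y => sw (comul (R := k) y) fun x' y₂ =>
        sw (comul (R := k) x') fun x₂ y₁ =>
        sw X.𝓡.mat fun r s => sw X.𝓡.mat fun r' s' => sw X.𝓡.mat fun p q =>
        X.𝓑.act (X.𝓑.antipode x₁) (r * p) * X.𝓑.act v q *
          X.𝓑.act (x₂ * X.𝓑.antipode y₁) r' * X.𝓑.act w (s * s') * y₂ := by
        refine sw_congr fun x₁ y => ?_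
        rw [sw_coassoc]
        refine sw_congr fun x₂ y => sw_congr fun y₁ y₂ => sw_congr fun r s => ?_
        rw [← X.𝓡.sw_mat_comul_left fun r' p' t => sw X.𝓡.mat fun p q =>
          X.𝓑.act (X.𝓑.antipode x₁) (r * p) * X.𝓑.act v q * X.𝓑.act x₂ r' *
          (X.𝓑.act (X.𝓑.antipode y₁) p' * X.𝓑.act w (s * t) * y₂)]
        simp only [X.𝓑.mul_act_sw, mul_sw, sw_mul, mul_assoc]
        exact sw_congr fun r' s' => sw_comm _ _ _
    _ = sw (comul (R := k) b) fun x y => sw X.𝓡.mat fun r s => sw X.𝓡.mat fun p q =>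
        X.𝓑.act (X.𝓑.antipode x) (r * p) * X.𝓑.act v q * X.𝓑.act w s * y := by
        refine sw_congr fun x₁ y => ?_
        rw [sw_congr fun x' y₂ => X.𝓑.sw_antipode_right (fun z =>
          sw X.𝓡.mat fun r s => sw X.𝓡.mat fun r' s' => sw X.𝓡.mat fun p q =>
          X.𝓑.act (X.𝓑.antipode x₁) (r * p) * X.𝓑.act v q * X.𝓑.act z r' *
            X.𝓑.act w (s * s') * y₂) x', sw_counit_left y fun y =>
          sw X.𝓡.mat fun r s => sw X.𝓡.mat fun r' s' => sw X.𝓡.mat fun p q =>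
          X.𝓑.act (X.𝓑.antipode x₁) (r * p) * X.𝓑.act v q * X.𝓑.act 1 r' *
            X.𝓑.act w (s * s') * y]
        refine sw_congr fun r s => ?_
        simp only [X.𝓑.one_act, smul_mul_assoc, mul_smul_comm, mul_one, ← smul_sw]
        rw [X.𝓡.sw_mat_counit_left fun s' => sw X.𝓡.mat fun p q =>
          X.𝓑.act (X.𝓑.antipode x₁) (r * p) * X.𝓑.act v q * X.𝓑.act w (s * s') * y, mul_one]
    _ = _ := by
        refine sw_congr fun x y => ?_
        rw [X.𝓡.sw_mat_comul_right fun r s₁ s₂ =>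
          X.𝓑.act (X.𝓑.antipode x) r * (X.𝓑.act v s₁ * X.𝓑.act w s₂) * y]
        simp only [mul_assoc]

/-! ### The coregular action -/

lemma coregularAct_eq (v : B) (c : C) :
    X.coregularAct v c = sw (comul (R := k) v) fun x y => sw X.𝓡.inv fun r s =>
      X.ev (X.barAntipode c) (X.𝓑.act y s) • X.𝓑.act x r := by
  rw [coregularAct, BraidedGroup.map₂_act_act]
  simp only [map_sw, Rinv_eq, LinearMap.lTensor_tmul, TensorProduct.rid_tmul]

/-- The relation h c = (h₁ ▷ c) h₂ of `U`, tested on B; it is the identity Δ(h) R⁻¹ = R⁻¹ τΔ(h). -/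
lemma coregularAct_act (v : B) (h : H) (c : C) :
    X.coregularAct (X.𝓑.act v h) c = sw (comul (R := k) h) fun p q =>
      X.𝓑.act (X.coregularAct v (X.barAct p c)) q := by
  simp only [coregularAct_eq, X.𝓑.sw_comul_act, map_sw_apply, map_smul, LinearMap.smul_apply,
    ev_barAntipode_barAct, ← X.𝓑.act_mul]
  simp only [sw_comm _ (comul (R := k) v)]
  refine sw_congr fun x y => ?_
  rw [X.𝓡.sw_comul_inv fun r s => X.ev (X.barAntipode c) (X.𝓑.act y s) • X.𝓑.act x r]

/-- The R⁻¹ left over in `ev_barAntipode_barMul` reverses Δ of the second leg of the outer R⁻¹.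
Expanding by one inverse hexagon and refolding by the other then gives two successive derivatives.
-/
lemma coregularAct_barMul (v : B) (c d : C) :
    X.coregularAct v (X.barMul c d) = X.coregularAct (X.coregularAct v c) d := by
  simp only [coregularAct_eq, ev_barAntipode_barMul, map_sw, sw_sw, map_smul, sw_smul,
    X.𝓑.sw_comul_act, sw_smul_left, smul_sw, ← X.𝓑.act_mul]
  calc _ = sw (comul (R := k) v) fun x y => sw (comul (R := k) y) fun y₁ y₂ =>
        sw X.𝓡.inv fun r s => sw (comul (R := k) s) fun s₁ s₂ => sw X.𝓡.inv fun p q =>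
        (X.ev (X.barAntipode d) (X.𝓑.act y₁ (p * s₂)) *
          X.ev (X.barAntipode c) (X.𝓑.act y₂ (q * s₁))) • X.𝓑.act x r := by
        refine sw_congr fun x y => ?_
        rw [sw_comm]
        refine sw_congr fun y₁ y₂ => sw_congr fun r s => ?_
        rw [X.𝓡.sw_comul_inv fun a b => (X.ev (X.barAntipode d) (X.𝓑.act y₁ a) *
          X.ev (X.barAntipode c) (X.𝓑.act y₂ b)) • X.𝓑.act x r]
    _ = sw (comul (R := k) v) fun x y => sw (comul (R := k) y) fun y₁ y₂ =>
        sw X.𝓡.inv fun r s => sw X.𝓡.inv fun r' s' => sw X.𝓡.inv fun p q =>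
        (X.ev (X.barAntipode d) (X.𝓑.act y₁ (p * s')) *
          X.ev (X.barAntipode c) (X.𝓑.act y₂ (q * s))) • X.𝓑.act x (r * r') := by
        refine sw_congr fun x y => sw_congr fun y₁ y₂ => ?_
        rw [X.𝓡.sw_inv_comul_right fun r s₁ s₂ => sw X.𝓡.inv fun p q =>
          (X.ev (X.barAntipode d) (X.𝓑.act y₁ (p * s₂)) *
          X.ev (X.barAntipode c) (X.𝓑.act y₂ (q * s₁))) • X.𝓑.act x r]
    _ = sw (comul (R := k) v) fun x y => sw (comul (R := k) y) fun y₁ y₂ =>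
        sw X.𝓡.inv fun r s => sw (comul (R := k) r) fun r₁ r₂ => sw X.𝓡.inv fun p q =>
        X.ev (X.barAntipode c) (X.𝓑.act y₂ s) •
          X.ev (X.barAntipode d) (X.𝓑.act y₁ (r₂ * q)) • X.𝓑.act x (r₁ * p) := by
        refine sw_congr fun x y => sw_congr fun y₁ y₂ => ?_
        rw [X.𝓡.sw_inv_comul_left fun r₁ r₂ s => sw X.𝓡.inv fun p q =>
          X.ev (X.barAntipode c) (X.𝓑.act y₂ s) •
          X.ev (X.barAntipode d) (X.𝓑.act y₁ (r₂ * q)) • X.𝓑.act x (r₁ * p)]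
        conv_rhs => rw [sw_comm]
        refine sw_congr fun r s => ?_
        rw [sw_comm]
        exact sw_congr fun p q => sw_congr fun r' s' => by rw [mul_comm, mul_smul]
    _ = _ := by
        rw [← sw_coassoc]
        exact sw_congr fun x y => sw_comm _ _ _

lemma coregularAct_one (v : B) : X.coregularAct v 1 = v := by
  simp only [coregularAct_eq, barAntipode_one, X.ev_one_left, X.𝓑.counit_act]
  refine (sw_congr fun x y => ?_).trans (sw_counit_right (k := k) v fun x => x)
  simp only [mul_smul, ← smul_sw]
  rw [X.𝓡.sw_inv_counit_right fun r => X.𝓑.act x r, X.𝓑.act_one]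

lemma one_coregularAct (c : C) : X.coregularAct 1 c = counit (R := k) c • (1 : B) := by
  rw [coregularAct_eq, X.𝓑.sw_comul_one fun x y => sw X.𝓡.inv fun r s =>
      X.ev (X.barAntipode c) (X.𝓑.act y s) • X.𝓑.act x r]
  simp only [X.𝓑.one_act, map_smul, X.ev_one_right, counit_barAntipode, smul_eq_mul]
  have h := X.𝓡.sw_inv_counit_left fun s => counit (R := k) s • counit (R := k) c • (1 : B)
  simpa [smul_smul, mul_comm, mul_left_comm, mul_assoc] using h

/-- `B` is a module algebra for the coregular action -/
lemma mul_coregularAct (v w : B) (c : C) :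
    X.coregularAct (v * w) c = sw (X.barComul c) fun x y => sw X.𝓡.inv fun r s =>
      X.𝓑.act (X.coregularAct v x) r * X.coregularAct w (X.barAct s y) := by
  simp only [coregularAct_eq, ev_barAntipode_mul, ev_barAntipode_barAct, map_sw, sw_apply,
    X.𝓑.sw_comul_mul, map_smul, LinearMap.smul_apply, sw_mul, mul_sw,
    X.𝓑.mul_act_sw, sw_smul_left, smul_sw, ← X.𝓑.act_mul]
  simp only [sw_comm _ (comul (R := k) w)]
  simp only [sw_comm _ (comul (R := k) v)]
  simp only [sw_comm _ (X.barComul c)]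
  refine sw_congr fun c₁ c₂ => sw_congr fun x y => sw_congr fun z w => ?_
  -- What remains is an identity between elements of H acting on v₁, v₂, w₁, w₂, in this order of
  -- legs.
  have h := X.𝓡.sw_mat_inv_comul_comul (bilin fun a t => sw t fun b t => sw t fun c d =>
    (X.ev (X.barAntipode c₁) (X.𝓑.act y b) * X.ev (X.barAntipode c₂) (X.𝓑.act w d)) •
      (X.𝓑.act x a * X.𝓑.act z c))
  simp only [bilin_tmul, sw_tmul] at h
  rw [h]
  simp only [mul_smul, smul_mul_assoc, mul_smul_comm]
  exact sw_congr fun _ _ => sw_congr fun _ _ => sw_congr fun _ _ => smul_comm _ _ _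

end Datum

lemma Lin.comp {k V W M : Type*} [CommSemiring k] [AddCommMonoid V] [Module k V]
    [AddCommMonoid W] [Module k W] [AddCommMonoid M] [Module k M] {f : W → M} (h : Lin k f)
    (φ : V →ₗ[k] W) : Lin k fun x => f (φ x) :=
  ⟨fun x y => by rw [map_add, h.map_add'], fun r x => by rw [map_smul, h.map_smul']⟩

/-! ### The identity in six tensor factors of H behind the cross relation. -/

section Leg

variable {k : Type*} {H : Type*} [Field k] [Ring H] [Algebra k H]
  {M : Type*} [AddCommMonoid M] [Module k M] {A : Type*} [Ring A] [Algebra k A]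

/-- the algebra `H ⊗ A`, as a type of its own -/
def Leg (k H A : Type*) [Field k] [Ring H] [Algebra k H] [Ring A] [Algebra k A] : Type _ :=
  H ⊗[k] A

namespace Leg

instance : Ring (Leg k H A) := inferInstanceAs (Ring (H ⊗[k] A))

instance : Algebra k (Leg k H A) := inferInstanceAs (Algebra k (H ⊗[k] A))

/-- the pure tensor `x ⊗ a` -/
def tens (x : H) (a : A) : Leg k H A := x ⊗ₜ[k] a

/-- the first factor of `H ⊗ A` -/
def inl : H →ₐ[k] Leg k H A := Algebra.TensorProduct.includeLeft (R := k) (S := k)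

/-- the second factor of `H ⊗ A` -/
def inr : A →ₐ[k] Leg k H A := Algebra.TensorProduct.includeRight

lemma tens_mul_tens (x y : H) (a b : A) :
    (tens x a * tens y b : Leg k H A) = tens (x * y) (a * b) :=
  Algebra.TensorProduct.tmul_mul_tmul _ _ _ _

/-- the linear map on `H ⊗ A` underlying a bilinear function -/
def desc (f : H → A → M) [∀ y, Lin k fun x => f x y] [∀ x, Lin k fun y => f x y] :
    Leg k H A →ₗ[k] M :=
  bilin (k := k) f

lemma desc_tens (f : H → A → M) [∀ y, Lin k fun x => f x y] [∀ x, Lin k fun y => f x y] (x : H)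
    (a : A) : desc (k := k) f (tens x a) = f x a :=
  bilin_tmul f x a

instance lin_desc {V : Type*} [AddCommMonoid V] [Module k V] (f : V → H → A → M)
    [∀ x y, Lin k fun v => f v x y] [∀ v y, Lin k fun x => f v x y] [∀ v x, Lin k fun y => f v x y]
    (t : Leg k H A) : Lin k fun v => desc (k := k) (f v) t := by
  have h : (fun v => desc (k := k) (f v) t) = fun v => sw (k := k) (t : H ⊗[k] A) (f v) :=
    funext fun v => bilin_eq_sw (f v) t
  rw [h]
  exact lin_sw_right (k := k) (P := H) (Q := A) t f

end Leg

end Leg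

namespace QuasitriangularStructure

variable {k : Type*} {H : Type*} [Field k] [Ring H] [HopfAlgebra k H]
  {M : Type*} [AddCommMonoid M] [Module k M]
  (𝓡 : QuasitriangularStructure k H) {A : Type*} [Ring A] [Algebra k A]

/-- Yang-Baxter with R_jl carried to the other side as an inverse, the form in which R⁻¹ slides
through a pair of R's. -/
lemma inv_mul_mat_mul_mat {i j l : H →ₐ[k] A} (h : ∀ x y, Commute (i x) (j y))
    (h₁ : ∀ x y, Commute (i x) (l y)) (h₂ : ∀ x y, Commute (j x) (l y)) :
    leg 𝓡.inv j l * leg 𝓡.mat i j * leg 𝓡.mat i l =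
      leg 𝓡.mat i l * leg 𝓡.mat i j * leg 𝓡.inv j l := by
  have e := 𝓡.yang_baxter h h₁ h₂
  calc _ = leg 𝓡.inv j l * (leg 𝓡.mat i j * leg 𝓡.mat i l * leg 𝓡.mat j l) *
        leg 𝓡.inv j l := by
        simp only [mul_assoc, leg_mat_inv 𝓡 h₂, mul_one]
    _ = (leg 𝓡.inv j l * leg 𝓡.mat j l) * leg 𝓡.mat i l * leg 𝓡.mat i j * leg 𝓡.inv j l := by
        rw [e]; simp only [mul_assoc]
    _ = _ := by rw [leg_inv_mat 𝓡 h₂, one_mul]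

lemma mat_mul_inv_mul_inv {i j l : H →ₐ[k] A} (h : ∀ x y, Commute (i x) (j y))
    (h₁ : ∀ x y, Commute (i x) (l y)) (h₂ : ∀ x y, Commute (j x) (l y)) :
    leg 𝓡.mat i j * leg 𝓡.inv j l * leg 𝓡.inv i l =
      leg 𝓡.inv i l * leg 𝓡.inv j l * leg 𝓡.mat i j := by
  have e := 𝓡.inv_mul_mat_mul_mat h h₁ h₂
  calc _ = (leg 𝓡.inv i l * leg 𝓡.mat i l) * leg 𝓡.mat i j * leg 𝓡.inv j l *
        leg 𝓡.inv i l := by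
        rw [leg_inv_mat 𝓡 h₁, one_mul]
    _ = leg 𝓡.inv i l * (leg 𝓡.inv j l * leg 𝓡.mat i j * leg 𝓡.mat i l) * leg 𝓡.inv i l := by
        rw [e]; simp only [mul_assoc]
    _ = _ := by simp only [mul_assoc, leg_mat_inv 𝓡 h₁, mul_one]

/-- the identity between products of R-matrices behind the cross relation of the double
bosonisation -/
lemma leg_cross {L : Fin 6 → H →ₐ[k] A}
    (hL : ∀ i j, i ≠ j → ∀ x y, Commute (L i x) (L j y)) :
    leg 𝓡.mat (diag (L 0) (L 1) (hL 0 1 (by decide))) (diag (L 4) (L 5) (hL 4 5 (by decide))) *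
      leg 𝓡.inv (L 4) (L 5) * leg 𝓡.inv (L 1) (L 5) * leg 𝓡.inv (L 2) (L 3) *
      leg 𝓡.inv (diag (L 1) (L 4) (hL 1 4 (by decide))) (L 3) =
    leg 𝓡.inv (L 4) (L 5) * leg 𝓡.mat (L 0) (L 4) * leg 𝓡.mat (L 0) (L 5) *
      leg 𝓡.inv (diag (L 1) (L 2) (hL 1 2 (by decide))) (L 3) * leg 𝓡.inv (L 4) (L 3) *
      leg 𝓡.mat (L 1) (L 4) := by
  -- In the application legs 0 to 5 act on b₁, S b₂, b₃, b₄, v₁, v₂. The hexagons reduce everything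
  -- to two-leg factors.
  have c (i j : Fin 6) (h : i ≠ j := by decide) := hL i j h
  rw [leg_mat_diag_left 𝓡 _ (diag_commute_right (c 4 5) (c 1 4) (c 1 5)),
    leg_mat_diag_right 𝓡 (c 4 5) (c 0 5), leg_mat_diag_right 𝓡 (c 4 5) (c 1 5),
    leg_inv_diag_left 𝓡 (c 1 4) (c 1 3) (c 4 3), leg_inv_diag_left 𝓡 (c 1 2) (c 1 3) (c 2 3)]
  have h₁ := 𝓡.inv_mul_mat_mul_mat (c 0 4) (c 0 5) (c 4 5)
  have h₂ := 𝓡.inv_mul_mat_mul_mat (c 1 4) (c 1 5) (c 4 5)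
  have h₃ := 𝓡.leg_mat_inv (c 1 5)
  have h₄ := leg_commute 𝓡.mat 𝓡.inv (c 1 2) (c 1 3) (c 4 2) (c 4 3)
  have h₅ := 𝓡.mat_mul_inv_mul_inv (c 1 4) (c 1 3) (c 4 3)
  -- Only five relations between the factors are needed from here: three mixed Yang-Baxter moves,
  -- one cancellation and one commutation of disjoint legs.
  generalize leg 𝓡.mat (L 0) (L 4) = m04, leg 𝓡.mat (L 0) (L 5) = m05,
    leg 𝓡.mat (L 1) (L 4) = m14, leg 𝓡.mat (L 1) (L 5) = m15, leg 𝓡.inv (L 4) (L 5) = i45,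
    leg 𝓡.inv (L 1) (L 5) = i15, leg 𝓡.inv (L 2) (L 3) = i23, leg 𝓡.inv (L 4) (L 3) = i43,
    leg 𝓡.inv (L 1) (L 3) = i13 at *
  calc _ = m05 * m04 * (m15 * m14 * i45) * i15 * i23 * (i43 * i13) := by simp only [mul_assoc]
    _ = m05 * m04 * i45 * m14 * (m15 * i15) * i23 * (i43 * i13) := by
      rw [← h₂]; simp only [mul_assoc]
    _ = (m05 * m04 * i45) * (m14 * i23) * (i43 * i13) := by
      rw [h₃, mul_one]; simp only [mul_assoc]
    _ = (i45 * m04 * m05) * i23 * (m14 * i43 * i13) := by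
      rw [h₄, h₁]; simp only [mul_assoc]
    _ = _ := by rw [h₅]; simp only [mul_assoc]

/-- the legs of the sixth tensor power of `H` -/
def sixLeg : Fin 6 → H →ₐ[k] Leg k H (Leg k H (Leg k H (Leg k H (Leg k H H)))) :=
  ![Leg.inl, Leg.inr.comp Leg.inl, Leg.inr.comp (Leg.inr.comp Leg.inl),
    Leg.inr.comp (Leg.inr.comp (Leg.inr.comp Leg.inl)),
    Leg.inr.comp (Leg.inr.comp (Leg.inr.comp (Leg.inr.comp Leg.inl))),
    Leg.inr.comp (Leg.inr.comp (Leg.inr.comp (Leg.inr.comp Leg.inr)))]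

open Leg in
lemma sixLeg_zero (x : H) :
    sixLeg (k := k) 0 x = tens x (tens 1 (tens 1 (tens 1 (tens 1 1)))) := rfl

open Leg in
lemma sixLeg_one (x : H) :
    sixLeg (k := k) 1 x = tens 1 (tens x (tens 1 (tens 1 (tens 1 1)))) := rfl

open Leg in
lemma sixLeg_two (x : H) :
    sixLeg (k := k) 2 x = tens 1 (tens 1 (tens x (tens 1 (tens 1 1)))) := rfl

open Leg in
lemma sixLeg_three (x : H) :
    sixLeg (k := k) 3 x = tens 1 (tens 1 (tens 1 (tens x (tens 1 1)))) := rfl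

open Leg in
lemma sixLeg_four (x : H) :
    sixLeg (k := k) 4 x = tens 1 (tens 1 (tens 1 (tens 1 (tens x 1)))) := rfl

open Leg in
lemma sixLeg_five (x : H) :
    sixLeg (k := k) 5 x = tens 1 (tens 1 (tens 1 (tens 1 (tens 1 x)))) := rfl

lemma sixLeg_commute (i j : Fin 6) (h : i ≠ j) (x y : H) :
    Commute (sixLeg (k := k) i x) (sixLeg j y) := by
  have e0 := sixLeg_zero (k := k) (H := H)
  have e1 := sixLeg_one (k := k) (H := H)
  have e2 := sixLeg_two (k := k) (H := H)
  have e3 := sixLeg_three (k := k) (H := H)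
  have e4 := sixLeg_four (k := k) (H := H)
  have e5 := sixLeg_five (k := k) (H := H)
  fin_cases i <;> fin_cases j <;> first
    | exact absurd rfl h
    | simp only [Commute, SemiconjBy, Fin.zero_eta, Fin.mk_one, Fin.reduceFinMk, e0, e1, e2, e3,
        e4, e5, Leg.tens_mul_tens, one_mul, mul_one]

open Leg in
/-- the identity `leg_cross` in terms of Sweedler sums -/
lemma sw_cross (Φ : Leg k H (Leg k H (Leg k H (Leg k H (Leg k H H)))) →ₗ[k] M) :
    (sw 𝓡.inv fun a a' => sw (comul (R := k) a) fun a₁ a₂ => sw 𝓡.inv fun t t' =>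
      sw 𝓡.inv fun e e' => sw 𝓡.inv fun p q => sw 𝓡.mat fun r s =>
      sw (comul (R := k) s) fun s₁ s₂ => sw (comul (R := k) r) fun r₁ r₂ =>
        Φ (tens r₁ (tens (r₂ * e * a₁) (tens t (tens (t' * a')
          (tens (s₁ * p * a₂) (s₂ * q * e'))))))) =
    sw 𝓡.mat fun u u' => sw 𝓡.inv fun c c' => sw 𝓡.inv fun d d' =>
      sw (comul (R := k) d) fun d₁ d₂ => sw 𝓡.mat fun m m' => sw 𝓡.mat fun n n' =>
      sw 𝓡.inv fun p q =>
        Φ (tens (n * m) (tens (d₁ * u) (tens d₂ (tens (d' * c')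
          (tens (p * n' * c * u') (q * m')))))) := by
  have h := congrArg Φ (leg_cross 𝓡 (sixLeg_commute (k := k) (H := H)))
  simpa only [leg, diag_apply, sw_mul, mul_sw, map_sw, sixLeg_zero, sixLeg_one, sixLeg_two,
    sixLeg_three, sixLeg_four, sixLeg_five, tens_mul_tens, one_mul, mul_one] using h

end QuasitriangularStructure

/-! ### The cross relation between B and C̄ acting on B. -/

namespace Datum

variable {k H B C : Type*} [Field k] [Ring H] [HopfAlgebra k H] [Ring B] [Algebra k B]
  [Coalgebra k B] [Ring C] [Algebra k C] [Coalgebra k C] (X : Datum k H B C)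
  {M : Type*} [AddCommMonoid M] [Module k M]

/-- the coregular action as a bilinear map -/
def coregular : B →ₗ[k] C →ₗ[k] B :=
  TensorProduct.curry (bilin fun v c => sw (comul (R := k) v) fun x y => sw X.𝓡.inv fun r s =>
    X.ev (X.barAntipode c) (X.𝓑.act y s) • X.𝓑.act x r)

lemma coregular_apply (v : B) (c : C) : X.coregular v c = X.coregularAct v c := by
  rw [coregularAct_eq]
  rfl

lemma coregular_eq (v : B) (c : C) :
    X.coregular v c = sw (comul (R := k) v) fun x y => sw X.𝓡.inv fun r s =>
      X.ev (X.barAntipode c) (X.𝓑.act y s) • X.𝓑.act x r := rfl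

lemma mul_coregular (v w : B) (c : C) :
    X.coregular (v * w) c = sw (X.barComul c) fun x y => sw X.𝓡.inv fun r s =>
      X.𝓑.act (X.coregular v x) r * X.coregular w (X.barAct s y) := by
  simp only [coregular_apply, mul_coregularAct]

lemma coregular_act (v : B) (h : H) (c : C) :
    X.coregular (X.𝓑.act v h) c = sw (comul (R := k) h) fun p q =>
      X.𝓑.act (X.coregular v (X.barAct p c)) q := by
  simp only [coregular_apply, coregularAct_act]

/-- The R from Δ(S b) cancels the R⁻¹ of the coregular action, and ⟨S̄ c, S x⟩ = ⟨c, x⟩. Hence the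
first pairing in the cross relation contains no antipode. -/
lemma coregular_antipode (b : B) (c : C) :
    X.coregular (X.𝓑.antipode b) c =
      sw (comul (R := k) b) fun x y => X.ev c x • X.𝓑.antipode y := by
  rw [coregular_eq, X.𝓑.sw_comul_antipode]
  refine sw_congr fun x y => ?_
  simp only [← X.𝓑.act_mul]
  rw [X.𝓡.sw_mat_inv fun r s => X.ev (X.barAntipode c) (X.𝓑.act (X.𝓑.antipode x) s) •
    X.𝓑.act (X.𝓑.antipode y) r, X.𝓑.act_one, X.𝓑.act_one, ev_barAntipode_antipode]

/-- By `sw_barComul` the coproduct of C̄ is that of C, flipped and transported along the antipode,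
so coassociativity is inherited without R-matrix computations. -/
lemma sw_barComul_coassoc (c : C) (f : C → C → C → M) [h₁ : ∀ y z, Lin k fun x => f x y z]
    [h₂ : ∀ x z, Lin k fun y => f x y z] [h₃ : ∀ x y, Lin k fun z => f x y z] :
    (sw (X.barComul c) fun x y => sw (X.barComul x) fun p q => f p q y) =
      sw (X.barComul c) fun x y => sw (X.barComul y) fun p q => f x p q := by
  have (y z : C) : Lin k fun x => f (X.𝓒.antipode x) y z := (h₁ y z).comp X.𝓒.antipode
  have (x z : C) : Lin k fun y => f x (X.𝓒.antipode y) z := (h₂ x z).comp X.𝓒.antipode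
  have (x y : C) : Lin k fun z => f x y (X.𝓒.antipode z) := (h₃ x y).comp X.𝓒.antipode
  rw [sw_barComul, sw_barComul]
  simp only [sw_barComul, barAntipode_antipode]
  exact (sw_coassoc (k := k) (X.barAntipode c) fun x y z =>
    f (X.𝓒.antipode z) (X.𝓒.antipode y) (X.𝓒.antipode x)).symm

lemma contract_eq (x y : H ⊗[k] H) (f : H →ₗ[k] H →ₗ[k] k) :
    X.contract x y f = sw x fun a b => sw y fun c d => f a c • b ⊗ₜ[k] d := by
  change TensorProduct.lid k (H ⊗[k] H) ((TensorProduct.lift f).rTensor (H ⊗[k] H)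
      (TensorProduct.tensorTensorTensorComm k H H H H (x ⊗ₜ[k] y))) = _
  conv_lhs => rw [← sw_tmul_self x, ← sw_tmul_self y]
  simp only [sw_tmul_left, sw_tmul_right, map_sw, TensorProduct.tensorTensorTensorComm_tmul,
    LinearMap.rTensor_tmul, TensorProduct.lift.tmul, TensorProduct.lid_tmul]
  rw [sw_comm]

lemma headPair_eq (c : C) (b : B) :
    X.headPair c b = sw X.𝓡.mat fun m m' => sw X.𝓡.mat fun n n' =>
      X.ev c (X.𝓑.act b (n * m)) • m' ⊗ₜ[k] n' := by
  change X.contract X.R X.R (X.pairAct c b) = _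
  rw [contract_eq]
  refine sw_congr fun m m' => sw_congr fun n n' => ?_
  rw [X.𝓑.act_mul, ← ev_barAct]
  rfl

lemma sw_comm_tensor (t : H ⊗[k] H) (f : H → H → M) [∀ y, Lin k fun x => f x y]
    [∀ x, Lin k fun y => f x y] :
    sw (TensorProduct.comm k H H t) f = sw t fun x y => f y x :=
  QuasitriangularStructure.sw_comm_tensor f t

lemma tailPair_eq (c : C) (b : B) :
    X.tailPair c b = sw X.𝓡.inv fun p q => sw X.𝓡.inv fun d d' =>
      X.ev (X.barAntipode c) (X.𝓑.act b (d' * q)) • p ⊗ₜ[k] d := by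
  change X.contract (TensorProduct.comm k H H X.𝓡.inv) (TensorProduct.comm k H H X.𝓡.inv)
    (X.pairAct (X.barAntipode c) b) = _
  rw [contract_eq, QuasitriangularStructure.sw_comm_tensor]
  simp only [sw_comm_tensor]
  refine sw_congr fun m m' => sw_congr fun n n' => ?_
  rw [X.𝓑.act_mul, ← ev_barAct]
  rfl

lemma lTensor_comp_eq {V : Type*} [AddCommGroup V] [Module k V] (δ : V →ₗ[k] V ⊗[k] V) (v : V) :
    δ.lTensor V (δ v) = sw (δ v) fun x y => sw (δ y) fun p q => x ⊗ₜ[k] (p ⊗ₜ[k] q) := by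
  rw [map_eq_sw (δ.lTensor V)]
  simp only [LinearMap.lTensor_tmul, ← sw_tmul_right, sw_tmul_self]

lemma crossAssemble_tmul (p q r s : H) (c : C) (b : B) :
    X.crossAssemble ((p ⊗ₜ[k] q) ⊗ₜ[k] ((c ⊗ₜ[k] b) ⊗ₜ[k] (r ⊗ₜ[k] s))) =
      X.barAct p c ⊗ₜ[k] ((q * r) ⊗ₜ[k] X.𝓑.act b s) := rfl

lemma cross_eq (b : B) (c : C) :
    X.cross b c = sw (X.barComul c) fun c₁ c' => sw (X.barComul c') fun c₂ c₃ =>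
      sw (comul (R := k) b) fun b₁ b' => sw (comul (R := k) b') fun b₂ b₃ =>
      sw X.𝓡.inv fun p q => sw X.𝓡.inv fun d d' => sw X.𝓡.mat fun m m' => sw X.𝓡.mat fun n n' =>
      X.ev (X.barAntipode c₃) (X.𝓑.act b₃ (d' * q)) • X.ev c₁ (X.𝓑.act b₁ (n * m)) •
        X.barAct m' c₂ ⊗ₜ[k] ((n' * p) ⊗ₜ[k] X.𝓑.act b₂ d) := by
  simp only [cross, LinearMap.flip_apply, TensorProduct.curry_apply, LinearMap.comp_apply,
    TensorProduct.map_tmul, LinearEquiv.coe_coe, lTensor_comp_eq]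
  simp only [sw_tmul_left, sw_tmul_right, map_sw, LinearMap.lTensor_tmul, TensorProduct.map_tmul,
    LinearEquiv.coe_coe,
    TensorProduct.tensorTensorTensorComm_tmul, TensorProduct.lift.tmul, headPair_eq, tailPair_eq]
  simp only [← TensorProduct.smul_tmul', TensorProduct.tmul_smul, map_smul, crossAssemble_tmul]
  simp only [sw_comm _ (X.barComul c)]
  refine sw_congr fun c₁ c' => ?_
  simp only [sw_comm _ (X.barComul c')]

/-- the candidate action of `U` on `B` -/
def fundamental : B →ₗ[k] C ⊗[k] (H ⊗[k] B) →ₗ[k] B :=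
  TensorProduct.curry (bilin fun v t => sw t fun c u => sw u fun h b =>
    X.adjointAct (X.𝓑.act (X.coregular v c) h) b)

lemma fundamental_tmul (v : B) (c : C) (h : H) (b : B) :
    X.fundamental v (c ⊗ₜ[k] (h ⊗ₜ[k] b)) = X.adjointAct (X.𝓑.act (X.coregular v c) h) b := by
  simp only [fundamental, TensorProduct.curry_apply, bilin_tmul, sw_tmul]

/-- the common form of the two sides of the cross relation, as a function of the six elements of `H`
acting on `b₁, b₂, b₃, b₄, v₁, v₂` -/
def crossForm (c₁ c₂ c₃ : C) (b₁ b₂ b₃ b₄ v₁ v₂ : B) :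
    Leg k H (Leg k H (Leg k H (Leg k H (Leg k H H)))) →ₗ[k] B :=
  Leg.desc fun x₀ t => Leg.desc (fun x₁ t => Leg.desc (fun x₂ t => Leg.desc (fun x₃ t =>
    Leg.desc (fun x₄ x₅ =>
      X.ev (X.barAntipode c₃) (X.𝓑.act b₄ x₃) • X.ev c₁ (X.𝓑.act b₁ x₀) •
        X.ev (X.barAntipode c₂) (X.𝓑.act v₂ x₅) •
          (X.𝓑.act (X.𝓑.antipode b₂) x₁ * X.𝓑.act v₁ x₄ * X.𝓑.act b₃ x₂)) t) t) t) t

section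

variable (c₁ c₂ c₃ : C) (b₁ b₂ b₃ b₄ v₁ v₂ : B)
  (t : Leg k H (Leg k H (Leg k H (Leg k H (Leg k H H)))))

/-- Linearity in the parts of d and of b is what coassociativity requires when the two sides are
regrouped in `fundamental_cross`. -/
instance : Lin k fun x => X.crossForm x c₂ c₃ b₁ b₂ b₃ b₄ v₁ v₂ t := by
  unfold crossForm
  infer_instance

instance : Lin k fun x => X.crossForm c₁ x c₃ b₁ b₂ b₃ b₄ v₁ v₂ t := by
  unfold crossForm
  infer_instance

instance : Lin k fun x => X.crossForm c₁ c₂ x b₁ b₂ b₃ b₄ v₁ v₂ t := by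
  unfold crossForm
  infer_instance

instance : Lin k fun x => X.crossForm c₁ c₂ c₃ x b₂ b₃ b₄ v₁ v₂ t := by
  unfold crossForm
  infer_instance

instance : Lin k fun x => X.crossForm c₁ c₂ c₃ b₁ x b₃ b₄ v₁ v₂ t := by
  unfold crossForm
  infer_instance

instance : Lin k fun x => X.crossForm c₁ c₂ c₃ b₁ b₂ x b₄ v₁ v₂ t := by
  unfold crossForm
  infer_instance

instance : Lin k fun x => X.crossForm c₁ c₂ c₃ b₁ b₂ b₃ x v₁ v₂ t := by
  unfold crossForm
  infer_instance

end

lemma crossForm_tens (c₁ c₂ c₃ : C) (b₁ b₂ b₃ b₄ v₁ v₂ : B) (x₀ x₁ x₂ x₃ x₄ x₅ : H) :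
    X.crossForm c₁ c₂ c₃ b₁ b₂ b₃ b₄ v₁ v₂
        (.tens x₀ (.tens x₁ (.tens x₂ (.tens x₃ (.tens x₄ x₅))))) =
      X.ev (X.barAntipode c₃) (X.𝓑.act b₄ x₃) • X.ev c₁ (X.𝓑.act b₁ x₀) •
        X.ev (X.barAntipode c₂) (X.𝓑.act v₂ x₅) •
          (X.𝓑.act (X.𝓑.antipode b₂) x₁ * X.𝓑.act v₁ x₄ * X.𝓑.act b₃ x₂) := by
  simp only [crossForm, Leg.desc_tens]

/-- Normal order: d₂ differentiates v first, then H acts, then the middle part of b acts adjointly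
and splits into b₂ and b₃. All H-actions are collected in one argument of `crossForm`. -/
lemma fundamental_cross_left (v b : B) (d : C) :
    X.fundamental v (X.cross b d) =
      sw (X.barComul d) fun c₁ c => sw (X.barComul c) fun c₂ c₃ =>
      sw (comul (R := k) b) fun b₁ b' => sw (comul (R := k) b') fun b'' b₄ =>
      sw (comul (R := k) b'') fun b₂ b₃ => sw (comul (R := k) v) fun v₁ v₂ =>
      sw X.𝓡.mat fun u u' => sw X.𝓡.inv fun c c' => sw X.𝓡.inv fun d d' =>
      sw (comul (R := k) d) fun d₁ d₂ => sw X.𝓡.mat fun m m' => sw X.𝓡.mat fun n n' =>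
      sw X.𝓡.inv fun p q =>
        X.crossForm c₁ c₂ c₃ b₁ b₂ b₃ b₄ v₁ v₂ (.tens (n * m) (.tens (d₁ * u) (.tens d₂
          (.tens (d' * c') (.tens (p * n' * c * u') (q * m')))))) := by
  rw [cross_eq]
  simp only [map_sw, map_smul, fundamental_tmul, adjointAct_eq, X.𝓑.sw_comul_act]
  simp only [coregular_eq, map_sw, sw_apply, map_smul, LinearMap.smul_apply, X.𝓑.antipode_act,
    ← X.𝓑.act_mul, ev_barAntipode_barAct, sw_mul, mul_sw, smul_sw,
    smul_mul_assoc, mul_smul_comm, crossForm_tens]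
  refine sw_congr fun c₁ c => sw_congr fun c₂ c₃ => sw_congr fun b₁ b' => sw_congr fun b'' b₄ => ?_
  simp only [sw_comm _ (comul (R := k) b'')]
  refine sw_congr fun b₂ b₃ => ?_
  simp only [sw_comm _ (comul (R := k) v)]
  refine sw_congr fun v₁ v₂ => ?_
  refine Eq.trans ?_ (sw_comm _ _ _)
  refine sw_congr fun c c' => ?_
  refine Eq.trans ?_ (sw_comm _ _ _)
  refine sw_congr fun d d' => ?_
  simp only [sw_comm _ (comul (R := k) d)]
  refine sw_congr fun d₁ d₂ => ?_
  refine Eq.trans ?_ (sw_comm _ _ _)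
  refine sw_congr fun m m' => ?_
  refine Eq.trans ?_ (sw_comm _ _ _)
  simp only [mul_assoc]

/-- The product S b' · v · b'' is differentiated by two uses of the Leibniz rule, so here b and d
are split with different bracketings than in `fundamental_cross_left`. -/
lemma fundamental_cross_right (v b : B) (d : C) :
    X.coregular (X.adjointAct v b) d =
      sw (X.barComul d) fun c c₃ => sw (X.barComul c) fun c₁ c₂ =>
      sw (comul (R := k) b) fun b' b'' => sw (comul (R := k) b') fun b₁ b₂ =>
      sw (comul (R := k) b'') fun b₃ b₄ => sw (comul (R := k) v) fun v₁ v₂ =>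
      sw X.𝓡.inv fun a a' => sw (comul (R := k) a) fun a₁ a₂ => sw X.𝓡.inv fun t t' =>
      sw X.𝓡.inv fun e e' => sw X.𝓡.inv fun p q => sw X.𝓡.mat fun r s =>
      sw (comul (R := k) s) fun s₁ s₂ => sw (comul (R := k) r) fun r₁ r₂ =>
        X.crossForm c₁ c₂ c₃ b₁ b₂ b₃ b₄ v₁ v₂ (.tens r₁ (.tens (r₂ * e * a₁) (.tens t
          (.tens (t' * a') (.tens (s₁ * p * a₂) (s₂ * q * e')))))) := by
  simp only [map_sw, adjointAct_eq, sw_apply, mul_coregular, coregular_act, coregular_antipode]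
  simp only [coregular_eq, map_sw, sw_apply, map_smul, LinearMap.smul_apply, X.𝓑.mul_act_sw,
    ← X.𝓑.act_mul, ev_barAntipode_barAct, ev_barAct, sw_mul, mul_sw, smul_sw,
    smul_mul_assoc, mul_smul_comm, crossForm_tens]
  simp only [sw_comm _ (X.barComul d)]
  refine sw_congr fun c c₃ => ?_
  simp only [sw_comm _ (X.barComul c)]
  refine sw_congr fun c₁ c₂ => ?_
  refine sw_congr fun b' b'' => ?_
  simp only [sw_comm _ (comul (R := k) b')]
  refine sw_congr fun b₁ b₂ => ?_
  simp only [sw_comm _ (comul (R := k) b'')]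
  refine sw_congr fun b₃ b₄ => ?_
  simp only [sw_comm _ (comul (R := k) v)]
  refine sw_congr fun v₁ v₂ => ?_
  refine (sw_comm _ _ _).trans (sw_congr fun a a' => ?_)
  simp only [sw_comm _ (comul (R := k) a)]
  refine sw_congr fun a₁ a₂ => ?_
  refine (sw_comm _ _ _).trans (sw_congr fun t t' => ?_)
  refine (sw_comm _ _ _).trans (sw_congr fun e e' => ?_)
  refine Eq.trans (sw_congr fun r s => ?_) (sw_comm _ _ _)
  refine Eq.trans ?_ (sw_comm _ _ _)
  simp only [sw_comm _ (comul (R := k) r)]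
  refine sw_congr fun r₁ r₂ => ?_
  rw [X.𝓡.sw_comul_inv fun x y => X.ev (X.barAntipode c₃) (X.𝓑.act b₄ (t' * a')) •
    X.ev c₁ (X.𝓑.act b₁ r₁) • X.ev (X.barAntipode c₂) (X.𝓑.act v₂ (y * e')) •
      (X.𝓑.act (X.𝓑.antipode b₂) (r₂ * e * a₁) * X.𝓑.act v₁ (x * a₂) * X.𝓑.act b₃ t)]
  refine sw_congr fun s₁ s₂ => sw_congr fun p q => ?_
  rw [smul_comm (X.ev (X.barAntipode c₂) _)]

/-- Once coassociativity of b and d aligns the bracketings, the two sides are `crossForm` applied to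
the two sides of `sw_cross`. -/
lemma fundamental_cross (v b : B) (d : C) :
    X.fundamental v (X.cross b d) = X.coregular (X.adjointAct v b) d := by
  rw [fundamental_cross_left, fundamental_cross_right, X.sw_barComul_coassoc d fun c₁ c₂ c₃ => _]
  refine sw_congr fun c₁ c => sw_congr fun c₂ c₃ => ?_
  refine Eq.trans ?_ (sw_coassoc (k := k) b fun b₁ b₂ b'' =>
    sw (comul (R := k) b'') fun b₃ b₄ => sw (comul (R := k) v) fun v₁ v₂ =>
      sw X.𝓡.inv fun a a' => sw (comul (R := k) a) fun a₁ a₂ => sw X.𝓡.inv fun t t' =>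
      sw X.𝓡.inv fun e e' => sw X.𝓡.inv fun p q => sw X.𝓡.mat fun r s =>
      sw (comul (R := k) s) fun s₁ s₂ => sw (comul (R := k) r) fun r₁ r₂ =>
        X.crossForm c₁ c₂ c₃ b₁ b₂ b₃ b₄ v₁ v₂ (.tens r₁ (.tens (r₂ * e * a₁) (.tens t
          (.tens (t' * a') (.tens (s₁ * p * a₂) (s₂ * q * e'))))))).symm
  refine sw_congr fun b₁ b' => ?_
  rw [← sw_coassoc (k := k) b' fun b₂ b₃ b₄ => _]
  refine sw_congr fun b'' b₄ => sw_congr fun b₂ b₃ => sw_congr fun v₁ v₂ => ?_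
  exact (X.𝓡.sw_cross _).symm

end Datum

/-! ### Assembling the action of U. -/

namespace Datum

variable {k H B C : Type*} [Field k] [Ring H] [HopfAlgebra k H] [Ring B] [Algebra k B]
  [Coalgebra k B] [Ring C] [Algebra k C] [Coalgebra k C] (X : Datum k H B C)

lemma rbosMul_tmul (h g : H) (b a : B) :
    X.rbosMul (h ⊗ₜ[k] b) (g ⊗ₜ[k] a) = sw (comul (R := k) g) fun p q =>
      (h * p) ⊗ₜ[k] (X.𝓑.act b q * a) := by
  change ((LinearMap.mul k B).flip a).lTensor H (TensorProduct.map₂ (LinearMap.mul k H) X.𝓑.act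
    (h ⊗ₜ[k] b) (comul (R := k) g)) = _
  rw [TensorProduct.map₂_apply_tmul, map_eq_sw (TensorProduct.map _ _), map_sw]
  rfl

lemma lbosMul_tmul (c d : C) (h g : H) (b : B) :
    X.lbosMul (c ⊗ₜ[k] h) (d ⊗ₜ[k] (g ⊗ₜ[k] b)) = sw (comul (R := k) h) fun p q =>
      X.barMul c (X.barAct p d) ⊗ₜ[k] ((q * g) ⊗ₜ[k] b) := by
  change (X.barMul c).rTensor (H ⊗[k] B) (TensorProduct.map₂ X.barAct
    (LinearMap.rTensorHom B ∘ₗ LinearMap.mul k H) (comul (R := k) h) (d ⊗ₜ[k] (g ⊗ₜ[k] b))) = _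
  rw [← LinearMap.flip_apply (TensorProduct.map₂ _ _),
    map_eq_sw ((TensorProduct.map₂ X.barAct _).flip _), map_sw]
  rfl

lemma mul_tmul (c d : C) (h : H) (b : B) (u : H ⊗[k] B) :
    X.mul (c ⊗ₜ[k] (h ⊗ₜ[k] b)) (d ⊗ₜ[k] u) =
      X.lbosMul (c ⊗ₜ[k] h) ((X.rbosMul.flip u).lTensor C (X.cross b d)) := rfl

lemma comulU_tmul (c : C) (h : H) (b : B) :
    X.comulU (c ⊗ₜ[k] (h ⊗ₜ[k] b)) = sw (X.barComul c) fun x y => sw X.𝓡.inv fun t t' =>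
      sw (comul (R := k) h) fun p q => sw (comul (R := k) b) fun z w => sw X.𝓡.mat fun r s =>
      (x ⊗ₜ[k] ((t * p) ⊗ₜ[k] X.𝓑.act z r)) ⊗ₜ[k] (X.barAct t' y ⊗ₜ[k] ((q * s) ⊗ₜ[k] w)) := by
  have e : X.tensorComul (c ⊗ₜ[k] (h ⊗ₜ[k] b)) = sw (X.barComul c) fun x y =>
      sw (comul (R := k) h) fun p q => sw (comul (R := k) b) fun z w =>
      (x ⊗ₜ[k] (p ⊗ₜ[k] z)) ⊗ₜ[k] (y ⊗ₜ[k] (q ⊗ₜ[k] w)) := by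
    change TensorProduct.tensorTensorTensorComm k C C (H ⊗[k] B) (H ⊗[k] B) (X.barComul c ⊗ₜ[k]
      TensorProduct.tensorTensorTensorComm k H H B B (comul h ⊗ₜ[k] comul b)) = _
    conv_lhs => rw [← sw_tmul_self (X.barComul c), ← sw_tmul_self (comul (R := k) h),
      ← sw_tmul_self (comul (R := k) b)]
    simp only [sw_tmul_left, sw_tmul_right, map_sw, TensorProduct.tensorTensorTensorComm_tmul]
    simp only [sw_comm _ (X.barComul c)]
    refine sw_congr fun x y => ?_
    rw [sw_comm]
  rw [comulU, LinearMap.comp_apply, LinearMap.comp_apply, e,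
    ← sw_tmul_self X.R, ← sw_tmul_self X.Rinv, R_eq, Rinv_eq]
  simp only [map_sw, sw_apply, TensorProduct.map₂_apply_tmul, TensorProduct.map_tmul]
  refine sw_congr fun x y => ?_
  refine Eq.trans ?_ (sw_comm _ _ _)
  refine sw_congr fun p q => ?_
  refine Eq.trans ?_ (sw_comm _ _ _)
  refine sw_congr fun z w => ?_
  refine (sw_comm _ _ _).trans ?_
  rfl

/-- The outer factors c ⊗ h and g ⊗ a of a product can be peeled off using the module properties of
each factor and their H-covariance. Only the reordered middle term t is left. -/
lemma fundamental_lbosMul (v : B) (c : C) (h g : H) (a : B) (t : C ⊗[k] (H ⊗[k] B)) :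
    X.fundamental v (X.lbosMul (c ⊗ₜ[k] h) ((X.rbosMul.flip (g ⊗ₜ[k] a)).lTensor C t)) =
      X.adjointAct (X.𝓑.act (X.fundamental (X.𝓑.act (X.coregular v c) h) t) g) a := by
  induction t using TensorProduct.induction_on with
  | zero => simp
  | add x y hx hy => simp only [map_add, hx, hy, LinearMap.add_apply]
  | tmul d u =>
    induction u using TensorProduct.induction_on with
    | zero => simp
    | add x y hx hy => simp only [TensorProduct.tmul_add, map_add, hx, hy, LinearMap.add_apply]
    | tmul g' b =>
      simp only [LinearMap.lTensor_tmul, LinearMap.flip_apply, rbosMul_tmul, sw_tmul_right, map_sw,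
        lbosMul_tmul, fundamental_tmul, act_adjointAct, sw_apply, adjointAct_mul, coregular_act]
      rw [sw_comm]
      simp only [coregular_apply, coregularAct_barMul, X.𝓑.act_mul]

lemma fundamental_mul (v : B) (x y : C ⊗[k] (H ⊗[k] B)) :
    X.fundamental v (X.mul x y) = X.fundamental (X.fundamental v x) y := by
  induction y using TensorProduct.induction_on with
  | zero => simp
  | add y y' hy hy' => simp only [map_add, hy, hy']
  | tmul d u =>
  induction u using TensorProduct.induction_on with
  | zero => simp
  | add y y' hy hy' => simp only [TensorProduct.tmul_add, map_add, hy, hy']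
  | tmul g a =>
  induction x using TensorProduct.induction_on with
  | zero => simp
  | add x x' hx hx' => simp only [map_add, LinearMap.add_apply, hx, hx']
  | tmul c u =>
  induction u using TensorProduct.induction_on with
  | zero => simp
  | add x x' hx hx' => simp only [TensorProduct.tmul_add, map_add, LinearMap.add_apply, hx, hx']
  | tmul h b =>
    rw [mul_tmul, fundamental_lbosMul, fundamental_cross, fundamental_tmul, fundamental_tmul]

/-- The three Leibniz rules, for C̄, H and B in succession, produce the terms of the coproduct of
`U` one for one. -/
lemma mul_fundamental (v w : B) (x : C ⊗[k] (H ⊗[k] B)) :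
    X.fundamental (v * w) x = LinearMap.mul' k B
      (TensorProduct.map₂ X.fundamental X.fundamental (v ⊗ₜ[k] w) (X.comulU x)) := by
  induction x using TensorProduct.induction_on with
  | zero => simp
  | add x x' hx hx' => simp only [map_add, hx, hx']
  | tmul c u =>
  induction u using TensorProduct.induction_on with
  | zero => simp
  | add x x' hx hx' => simp only [TensorProduct.tmul_add, map_add, hx, hx']
  | tmul h b =>
    rw [comulU_tmul, fundamental_tmul, mul_coregular]
    simp only [map_sw, TensorProduct.map₂_apply_tmul, TensorProduct.map_tmul,
      LinearMap.mul'_apply, fundamental_tmul, sw_apply, X.𝓑.mul_act_sw, mul_adjointAct,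
      ← X.𝓑.act_mul]

lemma one_fundamental (x : C ⊗[k] (H ⊗[k] B)) :
    X.fundamental 1 x = X.counitU x • (1 : B) := by
  induction x using TensorProduct.induction_on with
  | zero => simp
  | add x x' hx hx' => simp only [map_add, add_smul, hx, hx']
  | tmul c u =>
  induction u using TensorProduct.induction_on with
  | zero => simp
  | add x x' hx hx' => simp only [TensorProduct.tmul_add, map_add, add_smul, hx, hx']
  | tmul h b =>
    rw [fundamental_tmul, coregular_apply, one_coregularAct]
    simp only [map_smul, LinearMap.smul_apply, X.𝓑.one_act, one_adjointAct, smul_smul]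
    simp [counitU, mul_assoc]

lemma isRightModuleAlgebra_fundamental :
    IsRightModuleAlgebra X.mul X.one X.comulU X.counitU X.fundamental where
  act_one v := by
    rw [one, fundamental_tmul, coregular_apply, coregularAct_one, X.𝓑.act_one, adjointAct_one]
  act_mul := X.fundamental_mul
  one_act := X.one_fundamental
  mul_act := X.mul_fundamental

lemma barAct_unit (h : H) : X.barAct h 1 = counit (R := k) h • (1 : C) := by
  rw [barAct_apply, X.𝓒.one_act, counit_antipode]

lemma barComul_one : X.barComul 1 = (1 : C) ⊗ₜ[k] (1 : C) := by
  rw [← sw_tmul_self (X.barComul 1), sw_barComul, barAntipode_one, X.𝓒.sw_comul_one fun x y =>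
    X.𝓒.antipode y ⊗ₜ[k] X.𝓒.antipode x, X.𝓒.antipode_one]

/-- With d = 1 both pairings become counits, and these annihilate every copy of R and R⁻¹. -/
lemma cross_one_right (b : B) : X.cross b 1 = 1 ⊗ₜ[k] (1 ⊗ₜ[k] b) := by
  have e (b₁ b₂ b₃ : B) (p q d d' m m' n n' : H) :
      X.ev (X.barAntipode 1) (X.𝓑.act b₃ (d' * q)) • X.ev 1 (X.𝓑.act b₁ (n * m)) •
        X.barAct m' 1 ⊗ₜ[k] ((n' * p) ⊗ₜ[k] X.𝓑.act b₂ d) =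
      counit (R := k) b₁ • counit (R := k) b₃ • counit (R := k) q • counit (R := k) d' •
        counit (R := k) m • counit (R := k) m' • counit (R := k) n •
          (1 : C) ⊗ₜ[k] ((n' * p) ⊗ₜ[k] X.𝓑.act b₂ d) := by
    simp only [barAntipode_one, X.ev_one_left, X.𝓑.counit_act, Bialgebra.counit_mul, barAct_unit,
      ← TensorProduct.smul_tmul', smul_smul]
    congr 1
    ring
  simp only [cross_eq, barComul_one, sw_tmul, e]
  simp only [← smul_sw, X.𝓡.sw_mat_counit_left,
    X.𝓡.sw_inv_counit_right, one_mul, Bialgebra.counit_one, one_smul, X.𝓑.act_one,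
    sw_counit_left, sw_counit_right]

/-- The three factors generate `U`, which is what uniqueness rests on. -/
lemma mul_decompose (c : C) (h : H) (b : B) :
    X.mul (X.mul (c ⊗ₜ[k] (1 ⊗ₜ[k] 1)) (1 ⊗ₜ[k] (h ⊗ₜ[k] 1))) (1 ⊗ₜ[k] (1 ⊗ₜ[k] b)) =
      c ⊗ₜ[k] (h ⊗ₜ[k] b) := by
  have h₁ : X.rbosMul (1 ⊗ₜ[k] 1) (h ⊗ₜ[k] 1) = h ⊗ₜ[k] 1 := by
    simp only [rbosMul_tmul, X.𝓑.one_act, one_mul, mul_one, TensorProduct.tmul_smul]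
    exact sw_counit_right (k := k) h fun p => p ⊗ₜ[k] (1 : B)
  have h₂ : X.rbosMul (1 ⊗ₜ[k] 1) (1 ⊗ₜ[k] b) = 1 ⊗ₜ[k] b := by
    simp only [rbosMul_tmul, Bialgebra.comul_one, Algebra.TensorProduct.one_def, sw_tmul,
      X.𝓑.act_one, one_mul]
  have h₃ (g : H) (a : B) : X.lbosMul (c ⊗ₜ[k] g) (1 ⊗ₜ[k] (1 ⊗ₜ[k] a)) =
      c ⊗ₜ[k] (g ⊗ₜ[k] a) := by
    simp only [lbosMul_tmul, barAct_unit, map_smul, mul_one, ← TensorProduct.smul_tmul']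
    refine (sw_counit_left (k := k) g fun q => X.barMul c 1 ⊗ₜ[k] (q ⊗ₜ[k] a)).trans ?_
    rw [barMul, LinearMap.flip_apply, LinearMap.mul_apply', one_mul]
  have h₄ : X.lbosMul (c ⊗ₜ[k] 1) (1 ⊗ₜ[k] (h ⊗ₜ[k] 1)) = c ⊗ₜ[k] (h ⊗ₜ[k] 1) := by
    simp only [lbosMul_tmul, Bialgebra.comul_one, Algebra.TensorProduct.one_def, sw_tmul,
      barAct_unit, Bialgebra.counit_one, one_smul, one_mul]
    rw [barMul, LinearMap.flip_apply, LinearMap.mul_apply', one_mul]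
  rw [mul_tmul, cross_one_right, LinearMap.lTensor_tmul, LinearMap.flip_apply, h₁, h₄, mul_tmul,
    cross_one_right, LinearMap.lTensor_tmul, LinearMap.flip_apply, h₂, h₃]

end Datum

end DoubleBosonisation

end

open DoubleBosonisation in
theorem theorem3p12 {k H B C : Type*} [Field k] [Ring H] [HopfAlgebra k H]
    [Ring B] [Algebra k B] [Coalgebra k B] [Ring C] [Algebra k C] [Coalgebra k C]
    (X : Datum k H B C) :
    ∃! α : B →ₗ[k] (C ⊗[k] (H ⊗[k] B)) →ₗ[k] B,
      IsRightModuleAlgebra X.mul X.one X.comulU X.counitU α ∧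
      (∀ v b : B, α v (1 ⊗ₜ[k] (1 ⊗ₜ[k] b)) = X.adjointAct v b) ∧
      (∀ (v : B) (c : C), α v (c ⊗ₜ[k] (1 ⊗ₜ[k] 1)) = X.coregularAct v c) ∧
      (∀ (v : B) (h : H), α v (1 ⊗ₜ[k] (h ⊗ₜ[k] 1)) = X.𝓑.act v h) := by
  refine ⟨X.fundamental, ⟨X.isRightModuleAlgebra_fundamental, fun v b => ?_, fun v c => ?_,
    fun v h => ?_⟩, ?_⟩
  · rw [X.fundamental_tmul, X.coregular_apply, X.coregularAct_one, X.𝓑.act_one]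
  · rw [X.fundamental_tmul, X.coregular_apply, X.𝓑.act_one, X.adjointAct_one]
  · rw [X.fundamental_tmul, X.coregular_apply, X.coregularAct_one, X.adjointAct_one]
  -- On a pure tensor, written as c · h · b, any such action is determined by its values on the
  -- three factors.
  · rintro α ⟨hα, hB, hC, hH⟩
    refine LinearMap.ext fun v => TensorProduct.ext ?_
    refine LinearMap.ext fun c => TensorProduct.ext ?_
    refine LinearMap.ext fun h => LinearMap.ext fun b => ?_
    change α v (c ⊗ₜ[k] (h ⊗ₜ[k] b)) = X.fundamental v (c ⊗ₜ[k] (h ⊗ₜ[k] b))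
    rw [X.fundamental_tmul, ← X.mul_decompose, hα.act_mul, hα.act_mul, hB, hH, hC,
      X.coregular_apply]
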